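/- Conventions. A sequence (or double sequence) of rationals $r_i$ is computable if $r_i=(-1)^{s(i)}p(i)/q(i)$ with recursive functions $s,p,q$ into $\mathbb N$, $q(i)\neq 0$. A real $x$ is computable, $x\in\mathbb R_c$, if there is a computable rational sequence $(r_k)$ with $|x-r_k|\le 2^{-k}$ for all $k$; a vector is (Turing) computable if its components are. A real sequence $(x_n)$ is computable if there is a computable rational double sequence with $|x_n-r_{n,k}|<2^{-k}$ for all $n,k$; a sequence of vectors is computable if its components are. A function $f$ on a rectangle $S\subset\mathbb R^m$ with computable corner coordinates is a computable continuous function if it maps computable sequences in $S$ to computable sequences (Banach–Mazur computability) and there is a recursive $d:\mathbb N\to\mathbb N$ such that $\|x-y\|\le 2^{-d(k)}$ implies $|f(x)-f(y)|\le 2^{-k}$ for all $x,y\in S$, $k\in\mathbb N$. For $R=R_1\times R_2$, an assignment function of $f$ for the first coordinate is a function $G:R_2\to R_1$ with $G(x_2)\in\arg\min_{x_1\in R_1}f(x_1,x_2)$ for all $x_2\in R_2$. A global minimizer $(\hat x_1,\hat x_2)$ of $f$ on $R$ is reachable along the coordinate $x_2$ if for some assignment function $G$ one has $(G(x_2),x_2)\to(\hat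 x_1,\hat x_2)$ as $x_2\to\hat x_2$ from above, or as $x_2\to\hat x_2$ from below, within $R_2$. For a sequence $\xi=(\xi_n)$ of positive rationals put $g_n(x)=(x+\xi_n)^2$ for $x<-\xi_n$, $g_n(x)=0$ for $|x|\le\xi_n$, $g_n(x)=(x-\xi_n)^2$ for $x>\xi_n$, and $g_*(x)=\sum_{n=1}^\infty 2^{-n}g_n(x)$. For $\alpha>0$ put $$f_2(x_1,x_2)=\begin{cases}g_*(x_1)+x_2^2\,e^{-\alpha x_1}, & x_2<0,\\ g_*(x_1)+x_2^2\,e^{\alpha x_1}, & x_2\ge 0,\end{cases}\qquad (x_1,x_2)\in\mathbb R^2.$$ **Theorem.** Let $a,b>0$ be computable, $R_1=[-a,a]$, $R_2=[-b,b]$ and $R=R_1\times R_2$. There exist a strictly decreasing computable sequence $(\xi_n)$ of rationals with limit $\xi_*$, where $0<\xi_*<\min(1,a)$ and $\xi_*$ is not computable, such that for every computable $\alpha>0$ the function $f_2$ is a computable continuous function on $R$ with the following properties. 1. $f_2\in C^1(\mathbb R^2)$. 2. For every real $x_2\ne0$ the function $f_2(\cdot,x_2)$ is strictly convex on $\mathbb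 R$; for every $x_2\in\mathbb R_c$ it is a computable continuous function on $R_1$. 3. For every real $x_1$ the function $f_2(x_1,\cdot)$ is strictly convex on $\mathbb R$; for every $x_1\in\mathbb R_c$ it is a computable continuous function on $R_2$. 4. On $R$, and likewise on $\mathbb R^2$, every local minimizer of $f_2$ is a global minimizer, and the set of global minimizers is $[-\xi_*,\xi_*]\times\{0\}$. 5. The global minimizers of $f_2$ on $R$ that are reachable along the coordinate $x_2$ are exactly $(-\xi_*,0)$ and $(\xi_*,0)$; every global minimizer reachable along $x_2$ is not Turing computable. -/

import Mathlib

open Set Filter Topology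

noncomputable section

namespace CoordMin

/-! ### Computable reals, sequences and functions -/

/-- A family of rational numbers `r : ι → ℚ` (`ι = ℕ`, `ℕ × ℕ`) is computable if there are recursive
functions `s, p, q` into `ℕ` with `q ≠ 0` and `r i = (-1) ^ s i * p i / q i`. -/
def IsComputableRat {ι : Type} [Primcodable ι] (r : ι → ℚ) : Prop :=
  ∃ s p q : ι → ℕ, Computable s ∧ Computable p ∧ Computable q ∧
    ∀ i, q i ≠ 0 ∧ r i = (-1) ^ s i * (p i : ℚ) / (q i : ℚ)

/-- A real number is computable if some computable rational sequence converges to it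
effectively. -/
def IsComputableReal (x : ℝ) : Prop :=
  ∃ r : ℕ → ℚ, IsComputableRat r ∧ ∀ k, |x - (r k : ℝ)| ≤ (1 / 2 : ℝ) ^ k

/-- A sequence of real numbers is computable if it is approximated by a computable double sequence
of rational numbers, effectively and uniformly in the index. -/
def IsComputableSeq (x : ℕ → ℝ) : Prop :=
  ∃ r : ℕ × ℕ → ℚ, IsComputableRat r ∧ ∀ n k, |x n - (r (n, k) : ℝ)| < (1 / 2 : ℝ) ^ k

/-- A vector is computable if each of its components is. -/
def IsComputableVec {m : ℕ} (x : EuclideanSpace ℝ (Fin m)) : Prop :=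
  ∀ i, IsComputableReal (x i)

/-- A sequence of vectors is computable if each of its components is a computable sequence. -/
def IsComputableVecSeq {m : ℕ} (x : ℕ → EuclideanSpace ℝ (Fin m)) : Prop :=
  ∀ i, IsComputableSeq (fun n => x n i)

/-- The closed rectangle `[lo 0, hi 0] × ⋯ × [lo (m-1), hi (m-1)]` in `ℝ^m`. -/
def rect {m : ℕ} (lo hi : Fin m → ℝ) : Set (EuclideanSpace ℝ (Fin m)) :=
  {x | ∀ i, x i ∈ Icc (lo i) (hi i)}

/-- Banach--Mazur computability of `f` on `S`: computable sequences in `S` are mapped to computable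
sequences. -/
def IsBanachMazurOn {m : ℕ} (f : EuclideanSpace ℝ (Fin m) → ℝ)
    (S : Set (EuclideanSpace ℝ (Fin m))) : Prop :=
  ∀ x : ℕ → EuclideanSpace ℝ (Fin m), (∀ n, x n ∈ S) → IsComputableVecSeq x →
    IsComputableSeq (fun n => f (x n))

/-- Effective uniform continuity of `f` on `S`, with a recursive modulus of continuity `d`. -/
def IsEffUniformContOn {m : ℕ} (f : EuclideanSpace ℝ (Fin m) → ℝ)
    (S : Set (EuclideanSpace ℝ (Fin m))) : Prop :=
  ∃ d : ℕ → ℕ, Computable d ∧ ∀ k, ∀ x ∈ S, ∀ y ∈ S,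
    ‖x - y‖ ≤ (1 / 2 : ℝ) ^ d k → |f x - f y| ≤ (1 / 2 : ℝ) ^ k

/-- `f` is a computable continuous function on the (computable) rectangle `S`. -/
def IsComputableContOn {m : ℕ} (f : EuclideanSpace ℝ (Fin m) → ℝ)
    (S : Set (EuclideanSpace ℝ (Fin m))) : Prop :=
  IsBanachMazurOn f S ∧ IsEffUniformContOn f S

/-! ### Minimizers, assignment functions, reachability -/

/-- The set of all global minimizers of `f` in `S`. -/
def globalMinimizers {m : ℕ} (f : EuclideanSpace ℝ (Fin m) → ℝ)
    (S : Set (EuclideanSpace ℝ (Fin m))) : Set (EuclideanSpace ℝ (Fin m)) :=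
  {x | x ∈ S ∧ ∀ y ∈ S, f x ≤ f y}

/-- The product `R₁ × R₂` as a subset of the Euclidean plane. -/
def prodSet (R₁ R₂ : Set ℝ) : Set (EuclideanSpace ℝ (Fin 2)) :=
  {x | x 0 ∈ R₁ ∧ x 1 ∈ R₂}

/-- The set of minimizers over `R₁` of `f` in its first variable, for fixed second
variable `x₂`. -/
def minimizersFst (f : EuclideanSpace ℝ (Fin 2) → ℝ) (R₁ : Set ℝ) (x₂ : ℝ) : Set ℝ :=
  {x₁ | x₁ ∈ R₁ ∧ ∀ y ∈ R₁, f !₂[x₁, x₂] ≤ f !₂[y, x₂]}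

/-- `G` is an assignment function of `f` for the first coordinate. Only the values of `G` on `R₂`
matter. -/
def IsAssignmentFst (f : EuclideanSpace ℝ (Fin 2) → ℝ) (R₁ R₂ : Set ℝ) (G : ℝ → ℝ) : Prop :=
  ∀ x₂ ∈ R₂, G x₂ ∈ minimizersFst f R₁ x₂

/-- All limits of `(G x₂, x₂)` as `x₂ ∈ R₂ ∩ T` tends to `z`, where `G` runs through the assignment
functions for the first coordinate; `T` is `Ioi z` for limits from above and `Iio z` for limits from
below. There are no limits if `z` is not an accumulation point of `R₂ ∩ T`. -/
def assignmentLimits (f : EuclideanSpace ℝ (Fin 2) → ℝ) (R₁ R₂ T : Set ℝ) (z : ℝ) :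
    Set (EuclideanSpace ℝ (Fin 2)) :=
  {p | (𝓝[R₂ ∩ T] z).NeBot ∧ ∃ G : ℝ → ℝ, IsAssignmentFst f R₁ R₂ G ∧
    Tendsto (fun x₂ => !₂[G x₂, x₂]) (𝓝[R₂ ∩ T] z) (𝓝 p)}

/-- `p` is a global minimizer of `f` on `R₁ × R₂` that is reachable along the coordinate `x₂`. -/
def IsReachableSnd (f : EuclideanSpace ℝ (Fin 2) → ℝ) (R₁ R₂ : Set ℝ)
    (p : EuclideanSpace ℝ (Fin 2)) : Prop :=
  p ∈ globalMinimizers f (prodSet R₁ R₂) ∧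
    p ∈ assignmentLimits f R₁ R₂ (Ioi (p 1)) (p 1) ∪ assignmentLimits f R₁ R₂ (Iio (p 1)) (p 1)

/-! ### The function `f₂` -/

/-- The function that vanishes on `[-c, c]` and is `(|x| - c) ^ 2` outside (for `c ≥ 0`). -/
def gAux (c x : ℝ) : ℝ :=
  if x < -c then (x + c) ^ 2 else if x ≤ c then 0 else (x - c) ^ 2

/-- `g_*(x) = ∑_{n ≥ 1} 2^{-n} g_n(x)`, where `g_n` is `gAux (ξ n)`. -/
def gStar (ξ : ℕ → ℚ) (x : ℝ) : ℝ :=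
  ∑' n : ℕ, (1 / 2 : ℝ) ^ (n + 1) * gAux (ξ (n + 1)) x

/-- `f₂(x₁, x₂) = g_*(x₁) + x₂² e^{-α x₁}` for `x₂ < 0` and `g_*(x₁) + x₂² e^{α x₁}` for
`x₂ ≥ 0`. -/
def fTwo (ξ : ℕ → ℚ) (α : ℝ) (x : EuclideanSpace ℝ (Fin 2)) : ℝ :=
  gStar ξ (x 0) + x 1 ^ 2 * (if x 1 < 0 then Real.exp (-α * x 0) else Real.exp (α * x 0))

end CoordMin

end

open CoordMin

/-! The obstruction is a Specker sequence: rationals `ξ n` that are computable and strictly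
decreasing, while their limit `ξ_*` encodes the halting problem. The sum `g_*` uses only the `ξ n`,
and its weights make the series converge effectively, so `g_*` is computable; yet its zero set is
the intersection of the intervals `[-ξ n, ξ n]`, that is `[-ξ_*, ξ_*]`.

The term `x₂² e^{±αx₁}` is nonnegative and vanishes only for `x₂ = 0`, which gives the global
minimizers. It also breaks the tie along the flat segment. For `x₂ > 0` it increases in `x₁`, so a
minimizer `m` of the slice satisfies `m ≤ -ξ_*`; comparison with the value at `-ξ_*` gives `g_*(m) ≤
x₂²`, which forces `m → -ξ_*` as `x₂ → 0`. For `x₂ < 0` the picture is mirrored. Hence only the two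
non-computable endpoints are reachable.

The carrying lemmas are `not_isComputableReal_of_tendsto_specker`, `IsBddComputableSeq.gStar` and
`IsBddComputableSeq.exp` for computability, `isLocalMinOn_fTwo_mem` for local minimizers, and
`le_neg_of_mem_minimizersFst` with its mirror image for reachability. -/

/-! ### Recursive arithmetic on natural numbers -/

section NatComputability

variable {ι : Type*} [Primcodable ι]

theorem Computable.nat_add {f g : ι → ℕ} (hf : Computable f) (hg : Computable g) :
    Computable fun i => f i + g i :=
  Primrec.nat_add.to_comp.comp hf hg

theorem Computable.nat_sub {f g : ι → ℕ} (hf : Computable f) (hg : Computable g) :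
    Computable fun i => f i - g i :=
  Primrec.nat_sub.to_comp.comp hf hg

theorem Computable.nat_mul {f g : ι → ℕ} (hf : Computable f) (hg : Computable g) :
    Computable fun i => f i * g i :=
  Primrec.nat_mul.to_comp.comp hf hg

theorem Computable.nat_pow {f g : ι → ℕ} (hf : Computable f) (hg : Computable g) :
    Computable fun i => f i ^ g i :=
  (Primrec₂.unpaired'.1 Nat.Primrec.pow).to_comp.comp hf hg

theorem Computable.decide_nat_le {f g : ι → ℕ} (hf : Computable f) (hg : Computable g) :
    Computable fun i => decide (f i ≤ g i) :=
  Primrec.nat_le.decide.to_comp.comp hf hg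

theorem Computable.bool_not {f : ι → Bool} (hf : Computable f) : Computable fun i => !f i :=
  Primrec.not.to_comp.comp hf

theorem Computable.bool_and {f g : ι → Bool} (hf : Computable f) (hg : Computable g) :
    Computable fun i => f i && g i :=
  Primrec.and.to_comp.comp hf hg

end NatComputability

/-! ### Arithmetic of computable rational families -/

namespace CoordMin

section Rat

variable {ι κ : Type} [Primcodable ι] [Primcodable κ]

/-- A rational family is computable iff it is a quotient of computable integers by computable
nonzero naturals. -/
theorem isComputableRat_iff {r : ι → ℚ} : IsComputableRat r ↔
    ∃ u v w : ι → ℕ, Computable u ∧ Computable v ∧ Computable w ∧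
      ∀ i, w i ≠ 0 ∧ r i = ((u i : ℚ) - v i) / w i := by
  constructor
  · rintro ⟨s, p, q, hs, hp, hq, h⟩
    have hb : Computable fun i => (s i).bodd := Computable.nat_bodd.comp hs
    refine ⟨fun i => cond (s i).bodd 0 (p i), fun i => cond (s i).bodd (p i) 0, q,
      Computable.cond hb (Computable.const 0) hp, Computable.cond hb hp (Computable.const 0), hq,
      fun i => ⟨(h i).1, ?_⟩⟩
    rw [(h i).2]
    have key : ((-1 : ℚ)) ^ s i = cond (s i).bodd (-1) 1 := by
      cases hbi : (s i).bodd
      · have : Even (s i) := by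
          rw [Nat.even_iff, Nat.mod_two_of_bodd, hbi]; rfl
        simp [this.neg_one_pow]
      · have : Odd (s i) := by
          rw [Nat.odd_iff, Nat.mod_two_of_bodd, hbi]; rfl
        simp [this.neg_one_pow]
    rw [key]
    dsimp only
    cases (s i).bodd <;> simp
  · rintro ⟨u, v, w, hu, hv, hw, h⟩
    -- With truncated subtraction one of the two differences is zero, so their sum is `|u i - v i|`.
    refine ⟨fun i => cond (decide (v i ≤ u i)) 0 1, fun i => (u i - v i) + (v i - u i), w,
      Computable.cond (Computable.decide_nat_le hv hu) (Computable.const 0) (Computable.const 1),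
      (hu.nat_sub hv).nat_add (hv.nat_sub hu), hw, fun i => ⟨(h i).1, ?_⟩⟩
    rw [(h i).2]
    rcases le_total (v i) (u i) with hle | hle
    · simp [hle, Nat.sub_eq_zero_of_le hle, Nat.cast_sub hle]
    · rcases hle.eq_or_lt with heq | hlt
      · simp [heq]
      · simp [not_le.2 hlt, Nat.sub_eq_zero_of_le hle, Nat.cast_sub hle]

namespace IsComputableRat

theorem comp {r : ι → ℚ} (hr : IsComputableRat r) {f : κ → ι} (hf : Computable f) :
    IsComputableRat fun j => r (f j) := by
  obtain ⟨s, p, q, hs, hp, hq, h⟩ := hr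
  exact ⟨_, _, _, hs.comp hf, hp.comp hf, hq.comp hf, fun j => h (f j)⟩

theorem of_eq {r r' : ι → ℚ} (hr : IsComputableRat r) (h : ∀ i, r i = r' i) :
    IsComputableRat r' :=
  funext h ▸ hr

theorem const (c : ℚ) : IsComputableRat fun _ : ι => c := by
  refine isComputableRat_iff.2 ⟨fun _ => c.num.toNat, fun _ => (-c.num).toNat, fun _ => c.den,
    Computable.const _, Computable.const _, Computable.const _, fun _ => ⟨c.den_nz, ?_⟩⟩
  have h : ((c.num.toNat : ℤ) - ((-c.num).toNat : ℤ)) = c.num := by omega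
  have h' : ((c.num.toNat : ℚ) - ((-c.num).toNat : ℚ)) = c.num := by exact_mod_cast h
  rw [h', Rat.num_div_den]

theorem add {r t : ι → ℚ} (hr : IsComputableRat r) (ht : IsComputableRat t) :
    IsComputableRat fun i => r i + t i := by
  obtain ⟨u, v, w, hu, hv, hw, h⟩ := isComputableRat_iff.1 hr
  obtain ⟨u', v', w', hu', hv', hw', h'⟩ := isComputableRat_iff.1 ht
  refine isComputableRat_iff.2 ⟨_, _, _, (hu.nat_mul hw').nat_add (hu'.nat_mul hw),
    (hv.nat_mul hw').nat_add (hv'.nat_mul hw), hw.nat_mul hw',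
    fun i => ⟨mul_ne_zero (h i).1 (h' i).1, ?_⟩⟩
  have h1 : (w i : ℚ) ≠ 0 := Nat.cast_ne_zero.2 (h i).1
  have h2 : (w' i : ℚ) ≠ 0 := Nat.cast_ne_zero.2 (h' i).1
  rw [(h i).2, (h' i).2]
  push_cast
  field_simp
  ring

theorem neg {r : ι → ℚ} (hr : IsComputableRat r) : IsComputableRat fun i => -r i := by
  obtain ⟨u, v, w, hu, hv, hw, h⟩ := isComputableRat_iff.1 hr
  refine isComputableRat_iff.2 ⟨v, u, w, hv, hu, hw, fun i => ⟨(h i).1, ?_⟩⟩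
  rw [(h i).2]
  ring

theorem sub {r t : ι → ℚ} (hr : IsComputableRat r) (ht : IsComputableRat t) :
    IsComputableRat fun i => r i - t i :=
  (hr.add ht.neg).of_eq fun _ => (sub_eq_add_neg _ _).symm

theorem mul {r t : ι → ℚ} (hr : IsComputableRat r) (ht : IsComputableRat t) :
    IsComputableRat fun i => r i * t i := by
  obtain ⟨s, p, q, hs, hp, hq, h⟩ := hr
  obtain ⟨s', p', q', hs', hp', hq', h'⟩ := ht
  refine ⟨_, _, _, hs.nat_add hs', hp.nat_mul hp', hq.nat_mul hq',
    fun i => ⟨mul_ne_zero (h i).1 (h' i).1, ?_⟩⟩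
  dsimp only
  rw [(h i).2, (h' i).2, pow_add]
  push_cast
  rw [div_mul_div_comm]
  ring

theorem pow {r : ι → ℚ} (hr : IsComputableRat r) {f : ι → ℕ} (hf : Computable f) :
    IsComputableRat fun i => r i ^ f i := by
  obtain ⟨s, p, q, hs, hp, hq, h⟩ := hr
  refine ⟨_, _, _, hs.nat_mul hf, hp.nat_pow hf, hq.nat_pow hf,
    fun i => ⟨pow_ne_zero _ (h i).1, ?_⟩⟩
  dsimp only
  rw [(h i).2, div_pow, mul_pow, ← pow_mul]
  push_cast
  rfl

theorem cond {c : ι → Bool} (hc : Computable c) {r t : ι → ℚ} (hr : IsComputableRat r)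
    (ht : IsComputableRat t) : IsComputableRat fun i => cond (c i) (r i) (t i) := by
  obtain ⟨s, p, q, hs, hp, hq, h⟩ := hr
  obtain ⟨s', p', q', hs', hp', hq', h'⟩ := ht
  refine ⟨_, _, _, Computable.cond hc hs hs', Computable.cond hc hp hp',
    Computable.cond hc hq hq', fun i => ?_⟩
  dsimp only
  cases c i
  · exact h' i
  · exact h i

theorem decide_le {r t : ι → ℚ} (hr : IsComputableRat r) (ht : IsComputableRat t) :
    Computable fun i => decide (r i ≤ t i) := by
  obtain ⟨u, v, w, hu, hv, hw, h⟩ := isComputableRat_iff.1 hr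
  obtain ⟨u', v', w', hu', hv', hw', h'⟩ := isComputableRat_iff.1 ht
  refine (Computable.decide_nat_le ((hu.nat_mul hw').nat_add (hv'.nat_mul hw))
    ((hu'.nat_mul hw).nat_add (hv.nat_mul hw'))).of_eq fun i => ?_
  have h1 : (0 : ℚ) < w i := Nat.cast_pos.2 (Nat.pos_of_ne_zero (h i).1)
  have h2 : (0 : ℚ) < w' i := Nat.cast_pos.2 (Nat.pos_of_ne_zero (h' i).1)
  rw [decide_eq_decide, (h i).2, (h' i).2, div_le_div_iff₀ h1 h2, ← Nat.cast_le (α := ℚ)]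
  push_cast
  constructor <;> intro _ <;> linarith

theorem max {r t : ι → ℚ} (hr : IsComputableRat r) (ht : IsComputableRat t) :
    IsComputableRat fun i => max (r i) (t i) :=
  (cond (hr.decide_le ht) ht hr).of_eq fun i => by
    by_cases h : r i ≤ t i
    · simp [h]
    · simp [h, (not_le.1 h).le]

/-- Finite sums of computable rationals are computable, uniformly in the summation bound. -/
theorem sum_range {t : ι × ℕ → ℚ} (ht : IsComputableRat t) {f : ι → ℕ} (hf : Computable f) :
    IsComputableRat fun i => ∑ j ∈ Finset.range (f i), t (i, j) := by
  obtain ⟨u, v, w, hu, hv, hw, h⟩ := isComputableRat_iff.1 ht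
  -- A state `(U, V, W)` stands for the partial sum `(U - V) / W`, never reduced, so that each step
  -- needs only addition and multiplication in `ℕ`.
  let step : ι → ℕ × (ℕ × ℕ × ℕ) → ℕ × ℕ × ℕ := fun i a =>
    (a.2.1 * w (i, a.1) + u (i, a.1) * a.2.2.2, a.2.2.1 * w (i, a.1) + v (i, a.1) * a.2.2.2,
      a.2.2.2 * w (i, a.1))
  have hstep : Computable₂ step := by
    have hi : Computable fun p : ι × (ℕ × (ℕ × ℕ × ℕ)) => (p.1, p.2.1) :=
      Computable.fst.pair (Computable.fst.comp Computable.snd)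
    have hS : Computable fun p : ι × (ℕ × (ℕ × ℕ × ℕ)) => p.2.2 :=
      Computable.snd.comp Computable.snd
    have hU := Computable.fst.comp hS
    have hV := Computable.fst.comp (Computable.snd.comp hS)
    have hW := Computable.snd.comp (Computable.snd.comp hS)
    exact ((hU.nat_mul (hw.comp hi)).nat_add ((hu.comp hi).nat_mul hW)).pair
      (((hV.nat_mul (hw.comp hi)).nat_add ((hv.comp hi).nat_mul hW)).pair
        (hW.nat_mul (hw.comp hi)))
  let F : ι → ℕ → ℕ × ℕ × ℕ := fun i n =>
    Nat.rec (0, 0, 1) (fun y IH => step i (y, IH)) n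
  have hF : Computable fun i => F i (f i) :=
    Computable.nat_rec hf (Computable.const (0, 0, 1)) hstep
  have key : ∀ i n, (F i n).2.2 ≠ 0 ∧
      ∑ j ∈ Finset.range n, t (i, j) = (((F i n).1 : ℚ) - (F i n).2.1) / (F i n).2.2 := by
    intro i n
    induction n with
    | zero => simp [F]
    | succ n ih =>
      have hs : F i (n + 1) = step i (n, F i n) := rfl
      have h1 : (w (i, n) : ℚ) ≠ 0 := Nat.cast_ne_zero.2 (h _).1
      have h2 : ((F i n).2.2 : ℚ) ≠ 0 := Nat.cast_ne_zero.2 ih.1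
      refine ⟨by rw [hs]; exact mul_ne_zero ih.1 (h _).1, ?_⟩
      rw [Finset.sum_range_succ, ih.2, (h _).2, hs]
      simp only [step]
      push_cast
      field_simp
      ring
  exact isComputableRat_iff.2 ⟨_, _, _, Computable.fst.comp hF,
    Computable.fst.comp (Computable.snd.comp hF), Computable.snd.comp (Computable.snd.comp hF),
    fun i => key i (f i)⟩

end IsComputableRat

end Rat

end CoordMin

/-! ### The functions `g_n` -/

/-- Squaring removes the kink of the positive part: near `0` the function is `O(t²)`. Both `g_n` and
the `x₂`-factors of `f₂` owe their C¹ regularity to this. -/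
theorem hasDerivAt_max_zero_sq (t : ℝ) :
    HasDerivAt (fun t : ℝ => (max t 0) ^ 2) (2 * max t 0) t := by
  rcases lt_trichotomy t 0 with h | rfl | h
  · rw [max_eq_right h.le, mul_zero]
    refine (hasDerivAt_const t (0 : ℝ)).congr_of_eventuallyEq ?_
    filter_upwards [eventually_lt_nhds h] with s hs
    simp [hs.le]
  · rw [hasDerivAt_iff_isLittleO]
    refine Asymptotics.IsBigO.trans_isLittleO (g := fun t : ℝ => t ^ 2)
      (Asymptotics.IsBigO.of_bound 1 (Eventually.of_forall fun s => ?_)) ?_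
    · simp only [max_self, sub_zero, mul_zero, smul_zero, ne_eq, OfNat.ofNat_ne_zero,
        not_false_eq_true, zero_pow, norm_pow, one_mul]
      gcongr
      rw [Real.norm_eq_abs, Real.norm_eq_abs, abs_of_nonneg (le_max_right _ _)]
      exact max_le (le_abs_self _) (abs_nonneg _)
    · simpa using Asymptotics.isLittleO_pow_id (𝕜 := ℝ) one_lt_two
  · rw [max_eq_left h.le]
    have : HasDerivAt (fun t : ℝ => t ^ 2) (2 * t) t := by simpa using hasDerivAt_pow 2 t
    refine this.congr_of_eventuallyEq ?_
    filter_upwards [eventually_gt_nhds h] with s hs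
    simp [hs.le]

theorem contDiff_max_zero_sq : ContDiff ℝ 1 fun t : ℝ => (max t 0) ^ 2 := by
  rw [contDiff_one_iff_deriv]
  refine ⟨fun t => (hasDerivAt_max_zero_sq t).differentiableAt, ?_⟩
  rw [funext fun t => (hasDerivAt_max_zero_sq t).deriv]
  fun_prop

namespace CoordMin

section gAux

variable {c x y : ℝ}

/-- Dependence on `|x|` alone makes order, convexity and Lipschitz estimates immediate. -/
theorem gAux_eq_sq_abs (hc : 0 ≤ c) : gAux c x = (max (|x| - c) 0) ^ 2 := by
  unfold gAux
  split_ifs with h1 h2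
  · rw [abs_of_neg (by linarith), max_eq_left (by linarith)]; ring
  · rw [max_eq_right (by linarith [abs_le.2 ⟨not_lt.1 h1, h2⟩])]; ring
  · rw [abs_of_pos (by linarith), max_eq_left (by linarith)]

/-- This form, without absolute value, is the one that is differentiated and evaluated at rational
points. -/
theorem gAux_eq_add (hc : 0 ≤ c) :
    gAux c x = (max (x - c) 0) ^ 2 + (max (-x - c) 0) ^ 2 := by
  unfold gAux
  split_ifs with h1 h2
  · rw [max_eq_right (by linarith), max_eq_left (by linarith)]; ring
  · rw [max_eq_right (by linarith), max_eq_right (by linarith)]; ring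
  · rw [max_eq_left (by linarith), max_eq_right (by linarith)]; ring

theorem gAux_nonneg (hc : 0 ≤ c) : 0 ≤ gAux c x := by
  rw [gAux_eq_sq_abs hc]; positivity

theorem gAux_le_gAux (hc : 0 ≤ c) (h : |x| ≤ |y|) : gAux c x ≤ gAux c y := by
  rw [gAux_eq_sq_abs hc, gAux_eq_sq_abs hc]; gcongr

theorem gAux_pos (hc : 0 ≤ c) (h : c < |x|) : 0 < gAux c x := by
  rw [gAux_eq_sq_abs hc]
  exact pow_pos (lt_max_of_lt_left (sub_pos.2 h)) 2

theorem gAux_eq_zero (hc : 0 ≤ c) (h : |x| ≤ c) : gAux c x = 0 := by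
  rw [gAux_eq_sq_abs hc, max_eq_right (sub_nonpos.2 h)]; ring

theorem gAux_le_sq (hc : 0 ≤ c) : gAux c x ≤ x ^ 2 := by
  rw [gAux_eq_sq_abs hc, ← sq_abs x]
  gcongr
  exact max_le (by linarith) (abs_nonneg x)

theorem abs_gAux_sub_le (hc : 0 ≤ c) : |gAux c x - gAux c y| ≤ (|x| + |y|) * |x - y| := by
  rw [gAux_eq_sq_abs hc, gAux_eq_sq_abs hc, sq_sub_sq, abs_mul]
  have h : ∀ z : ℝ, max (|z| - c) 0 ≤ |z| := fun z => max_le (by linarith) (abs_nonneg z)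
  refine mul_le_mul ?_ ?_ (abs_nonneg _) (by positivity)
  · rw [abs_of_nonneg (by positivity)]
    exact add_le_add (h x) (h y)
  · refine (abs_max_sub_max_le_abs _ _ _).trans ?_
    rw [sub_sub_sub_cancel_right]
    exact abs_abs_sub_abs_le x y

theorem convexOn_gAux (hc : 0 ≤ c) : ConvexOn ℝ univ (gAux c) := by
  have h : ConvexOn ℝ univ fun x : ℝ => |x| - c :=
    (convexOn_norm convex_univ (E := ℝ)).sub (concaveOn_const c convex_univ)
  have := (h.sup (convexOn_const 0 convex_univ)).pow (fun t _ => le_max_right _ 0) 2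
  exact this.congr fun x _ => (gAux_eq_sq_abs hc).symm

theorem hasDerivAt_gAux (hc : 0 ≤ c) (x : ℝ) :
    HasDerivAt (gAux c) (2 * max (x - c) 0 - 2 * max (-x - c) 0) x := by
  have h1 := (hasDerivAt_max_zero_sq (x - c)).comp x ((hasDerivAt_id x).sub_const c)
  have h2 := (hasDerivAt_max_zero_sq (-x - c)).comp x ((hasDerivAt_neg x).sub_const c)
  refine ((h1.add h2).congr_deriv (by ring)).congr_of_eventuallyEq
    (Eventually.of_forall fun y => ?_)
  exact gAux_eq_add hc

theorem abs_deriv_gAux_le (hc : 0 ≤ c) (x : ℝ) :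
    |2 * max (x - c) 0 - 2 * max (-x - c) 0| ≤ 2 * |x| := by
  have h1 : max (x - c) 0 ≤ |x| := max_le (by linarith [le_abs_self x]) (abs_nonneg x)
  have h2 : max (-x - c) 0 ≤ |x| := max_le (by linarith [neg_le_abs x]) (abs_nonneg x)
  have h3 := le_max_right (x - c) 0
  have h4 := le_max_right (-x - c) 0
  rw [abs_le]
  constructor <;> linarith

end gAux

/-! ### The series `g_*` -/

section gStar

variable {ξ : ℕ → ℚ} {x y : ℝ}

theorem summable_half_pow_succ_mul (C : ℝ) : Summable fun n : ℕ => (1 / 2 : ℝ) ^ (n + 1) * C :=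
  ((summable_nat_add_iff 1).2 summable_geometric_two).mul_right C

theorem summable_gStar (hξ : ∀ n, 0 ≤ ξ n) (x : ℝ) :
    Summable fun n : ℕ => (1 / 2 : ℝ) ^ (n + 1) * gAux (ξ (n + 1)) x :=
  Summable.of_nonneg_of_le
    (fun n => mul_nonneg (by positivity) (gAux_nonneg (Rat.cast_nonneg.2 (hξ _))))
    (fun n => mul_le_mul_of_nonneg_left (gAux_le_sq (Rat.cast_nonneg.2 (hξ _))) (by positivity))
    (summable_half_pow_succ_mul (x ^ 2))

theorem gStar_nonneg (hξ : ∀ n, 0 ≤ ξ n) : 0 ≤ gStar ξ x :=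
  tsum_nonneg fun _ => mul_nonneg (by positivity) (gAux_nonneg (Rat.cast_nonneg.2 (hξ _)))

theorem gStar_le_gStar (hξ : ∀ n, 0 ≤ ξ n) (h : |x| ≤ |y|) : gStar ξ x ≤ gStar ξ y :=
  (summable_gStar hξ x).tsum_le_tsum (fun _ => mul_le_mul_of_nonneg_left
    (gAux_le_gAux (Rat.cast_nonneg.2 (hξ _)) h) (by positivity)) (summable_gStar hξ y)

theorem gStar_eq_zero_of_forall_le (hξ : ∀ n, 0 ≤ ξ n) (h : ∀ n, |x| ≤ ξ n) :
    gStar ξ x = 0 := by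
  unfold gStar
  rw [tsum_congr fun n => by rw [gAux_eq_zero (Rat.cast_nonneg.2 (hξ _)) (h (n + 1)), mul_zero]]
  exact tsum_zero

theorem gStar_pos (hξ : ∀ n, 0 ≤ ξ n) {n : ℕ} (h : ξ (n + 1) < |x|) : 0 < gStar ξ x :=
  (summable_gStar hξ x).tsum_pos
    (fun _ => mul_nonneg (by positivity) (gAux_nonneg (Rat.cast_nonneg.2 (hξ _)))) n
    (mul_pos (by positivity) (gAux_pos (Rat.cast_nonneg.2 (hξ _)) h))

theorem convexOn_gStar (hξ : ∀ n, 0 ≤ ξ n) : ConvexOn ℝ univ (gStar ξ) := by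
  refine ⟨convex_univ, fun x _ y _ s t hs ht hst => ?_⟩
  simp only [smul_eq_mul]
  unfold gStar
  rw [← tsum_mul_left, ← tsum_mul_left, ← ((summable_gStar hξ x).mul_left s).tsum_add
    ((summable_gStar hξ y).mul_left t)]
  refine (summable_gStar hξ _).tsum_le_tsum (fun n => ?_)
    (((summable_gStar hξ x).mul_left s).add ((summable_gStar hξ y).mul_left t))
  have := (convexOn_gAux (c := ξ (n + 1)) (Rat.cast_nonneg.2 (hξ _))).2
    (mem_univ x) (mem_univ y) hs ht hst
  simp only [smul_eq_mul] at this
  calc _ ≤ (1 / 2 : ℝ) ^ (n + 1) * (s * gAux (ξ (n + 1)) x + t * gAux (ξ (n + 1)) y) := by gcongr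
    _ = _ := by ring

/-- The bound `g_n(x) ≤ x²` does not depend on `ξ`, so the rate of convergence is explicit and no
knowledge of `ξ_*` is needed. -/
theorem abs_gStar_sub_sum_le (hξ : ∀ n, 0 ≤ ξ n) (x : ℝ) (k : ℕ) :
    |gStar ξ x - ∑ n ∈ Finset.range k, (1 / 2 : ℝ) ^ (n + 1) * gAux (ξ (n + 1)) x| ≤
      x ^ 2 * (1 / 2) ^ k := by
  have hs := summable_gStar hξ x
  have := dist_le_of_le_geometric_two_of_tendsto (C := x ^ 2)
    (f := fun k => ∑ n ∈ Finset.range k, (1 / 2 : ℝ) ^ (n + 1) * gAux (ξ (n + 1)) x)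
    (fun n => ?_) hs.hasSum.tendsto_sum_nat k
  · rw [dist_comm, Real.dist_eq] at this
    refine this.trans_eq ?_
    rw [one_div, inv_pow, div_eq_mul_inv]
  · have h0 : 0 ≤ gAux (ξ (n + 1)) x := gAux_nonneg (Rat.cast_nonneg.2 (hξ _))
    rw [dist_comm, Real.dist_eq, Finset.sum_range_succ, add_sub_cancel_left,
      abs_of_nonneg (by positivity)]
    calc _ ≤ (1 / 2 : ℝ) ^ (n + 1) * x ^ 2 := by
          gcongr; exact gAux_le_sq (Rat.cast_nonneg.2 (hξ _))
      _ = _ := by rw [pow_succ, one_div, inv_pow]; ring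

/-- On a ball of radius `M` the termwise derivatives are dominated by `2M` times the weights, so
termwise differentiation is legitimate locally. -/
theorem contDiff_gStar (hξ : ∀ n, 0 ≤ ξ n) : ContDiff ℝ 1 (gStar ξ) := by
  let d : ℕ → ℝ → ℝ := fun n x => (1 / 2 : ℝ) ^ (n + 1) *
    (2 * max (x - ξ (n + 1)) 0 - 2 * max (-x - ξ (n + 1)) 0)
  have hbound : ∀ M : ℝ, ∀ n, ∀ x ∈ Metric.ball (0 : ℝ) M,
      ‖d n x‖ ≤ (1 / 2 : ℝ) ^ (n + 1) * (2 * M) := fun M n x hx => by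
    rw [mem_ball_zero_iff, Real.norm_eq_abs] at hx
    rw [Real.norm_eq_abs, abs_mul, abs_of_nonneg (by positivity : (0 : ℝ) ≤ (1 / 2) ^ (n + 1))]
    gcongr
    exact (abs_deriv_gAux_le (Rat.cast_nonneg.2 (hξ _)) x).trans (by gcongr)
  have hmem : ∀ x : ℝ, x ∈ Metric.ball (0 : ℝ) (|x| + 1) := fun x => by simp
  have hderiv : ∀ x, HasDerivAt (gStar ξ) (∑' n, d n x) x := fun x =>
    hasDerivAt_tsum_of_isPreconnected (summable_half_pow_succ_mul (2 * (|x| + 1)))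
      Metric.isOpen_ball (convex_ball (0 : ℝ) (|x| + 1)).isPreconnected
      (fun n y _ => (hasDerivAt_gAux (Rat.cast_nonneg.2 (hξ _)) y).const_mul _)
      (hbound _) (hmem x) (summable_gStar hξ x) (hmem x)
  rw [contDiff_one_iff_deriv]
  refine ⟨fun x => (hderiv x).differentiableAt, ?_⟩
  rw [funext fun x => (hderiv x).deriv, continuous_iff_continuousAt]
  intro x
  refine (continuousOn_tsum (fun n => ?_) (summable_half_pow_succ_mul (2 * (|x| + 1)))
    (hbound _)).continuousAt (Metric.isOpen_ball.mem_nhds (hmem x))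
  exact Continuous.continuousOn (by fun_prop)

end gStar

end CoordMin

/-! ### Bounded computable sequences of reals -/

namespace CoordMin

/-- A shift of the precision index by `c` with `C < 2 ^ c` absorbs the constant and restores the
strict inequality. The constant only has to exist. -/
theorem isComputableSeq_of_le {x : ℕ → ℝ} {r : ℕ × ℕ → ℚ} (hr : IsComputableRat r) (C : ℝ)
    (h : ∀ n k, |x n - (r (n, k) : ℝ)| ≤ C * (1 / 2 : ℝ) ^ k) : IsComputableSeq x := by
  obtain ⟨c, hc⟩ := pow_unbounded_of_one_lt C one_lt_two
  refine ⟨_, hr.comp (f := fun p : ℕ × ℕ => (p.1, p.2 + c))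
    (Computable.fst.pair (Computable.snd.nat_add (Computable.const c))), fun n k => ?_⟩
  refine (h n (k + c)).trans_lt ?_
  have : (1 / 2 : ℝ) ^ k = 2 ^ c * (1 / 2 : ℝ) ^ (k + c) := by
    rw [pow_add, mul_comm ((1 / 2 : ℝ) ^ k), ← mul_assoc, ← mul_pow]
    norm_num
  rw [this]
  gcongr

theorem IsComputableReal.isComputableSeq {x : ℝ} (hx : IsComputableReal x) :
    IsComputableSeq fun _ => x := by
  obtain ⟨r, hr, h⟩ := hx
  exact isComputableSeq_of_le (hr.comp Computable.snd) 1 fun n k => by simpa using h k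

theorem IsComputableReal.neg {x : ℝ} (hx : IsComputableReal x) : IsComputableReal (-x) := by
  obtain ⟨r, hr, h⟩ := hx
  refine ⟨_, hr.neg, fun k => ?_⟩
  rw [Rat.cast_neg, neg_sub_neg, abs_sub_comm]
  exact h k

/-- Bounded computable sequences of real numbers. -/
def IsBddComputableSeq (x : ℕ → ℝ) : Prop :=
  IsComputableSeq x ∧ ∃ M : ℝ, ∀ n, |x n| ≤ M

theorem IsComputableReal.isBddComputableSeq {x : ℝ} (hx : IsComputableReal x) :
    IsBddComputableSeq fun _ => x :=
  ⟨hx.isComputableSeq, |x|, fun _ => le_rfl⟩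

/-- Both sides are `N`-th powers, as `exp x = exp (x / N) ^ N`. The bases differ by at most `(M /
N)² + δ / N` and are bounded by `exp (M / N)`, so the error of the powers is at most `N` times this
difference times `exp M`. -/
theorem exp_sub_one_add_div_pow_le {x r M δ : ℝ} {N : ℕ} (hN : N ≠ 0) (hx : |x| ≤ M)
    (hr : |r| ≤ M) (hMN : M ≤ N) (hxr : |x - r| ≤ δ) :
    |Real.exp x - (1 + r / N) ^ N| ≤ (M ^ 2 / N + δ) * Real.exp M := by
  have hN0 : (0 : ℝ) < N := by positivity
  have hM : 0 ≤ M := (abs_nonneg x).trans hx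
  have hexp : Real.exp x = Real.exp (x / N) ^ N := by
    rw [← Real.exp_nat_mul, mul_div_cancel₀ _ hN0.ne']
  have h1 : |Real.exp (x / N) - (1 + r / N)| ≤ (M / N) ^ 2 + δ / N := by
    have e1 : |x / N| ≤ M / N := by rw [abs_div, abs_of_pos hN0]; gcongr
    have e2 := Real.abs_exp_sub_one_sub_id_le (e1.trans ((div_le_one hN0).2 hMN))
    have e3 : |(x - r) / N| ≤ δ / N := by rw [abs_div, abs_of_pos hN0]; gcongr
    have e4 : Real.exp (x / N) - (1 + r / N) =
        (Real.exp (x / N) - 1 - x / N) + (x - r) / N := by ring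
    rw [e4]
    refine (abs_add_le _ _).trans (add_le_add (e2.trans ?_) e3)
    rw [← sq_abs]
    gcongr
  have h2 : max |Real.exp (x / N)| |1 + r / N| ≤ Real.exp (M / N) := by
    refine max_le ?_ ?_
    · rw [abs_of_pos (Real.exp_pos _)]
      gcongr
      exact (le_abs_self x).trans hx
    · calc |1 + r / N| ≤ |1| + |r / N| := abs_add_le _ _
        _ ≤ M / N + 1 := by
          rw [abs_one, abs_div, abs_of_pos hN0, add_comm]; gcongr
        _ ≤ _ := Real.add_one_le_exp _
  have hδ : 0 ≤ δ := (abs_nonneg _).trans hxr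
  rw [hexp]
  calc _ ≤ |Real.exp (x / N) - (1 + r / N)| * N *
        max |Real.exp (x / N)| |1 + r / N| ^ (N - 1) := abs_pow_sub_pow_le ..
    _ ≤ ((M / N) ^ 2 + δ / N) * N * Real.exp (M / N) ^ (N - 1) := by gcongr
    _ ≤ ((M / N) ^ 2 + δ / N) * N * Real.exp (M / N) ^ N := by
      gcongr
      · exact Real.one_le_exp (by positivity)
      · omega
    _ = _ := by
      rw [← Real.exp_nat_mul, mul_div_cancel₀ _ hN0.ne']
      field_simp

namespace IsBddComputableSeq

variable {x y : ℕ → ℝ}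

theorem of_eq (hx : IsBddComputableSeq x) (h : ∀ n, x n = y n) : IsBddComputableSeq y :=
  funext h ▸ hx

theorem neg (hx : IsBddComputableSeq x) : IsBddComputableSeq fun n => -x n := by
  obtain ⟨⟨r, hr, h⟩, M, hM⟩ := hx
  refine ⟨isComputableSeq_of_le hr.neg 1 fun n k => ?_, M, fun n => by simpa using hM n⟩
  rw [one_mul, Rat.cast_neg, neg_sub_neg, abs_sub_comm]
  exact (h n k).le

theorem add (hx : IsBddComputableSeq x) (hy : IsBddComputableSeq y) :
    IsBddComputableSeq fun n => x n + y n := by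
  obtain ⟨⟨r, hr, h⟩, M, hM⟩ := hx
  obtain ⟨⟨t, ht, h'⟩, M', hM'⟩ := hy
  refine ⟨isComputableSeq_of_le (hr.add ht) 2 fun n k => ?_, M + M', fun n =>
    (abs_add_le _ _).trans (add_le_add (hM n) (hM' n))⟩
  push_cast
  rw [add_sub_add_comm, two_mul]
  exact (abs_add_le _ _).trans (add_le_add (h n k).le (h' n k).le)

theorem abs_approx_le {M : ℝ} {r : ℕ × ℕ → ℚ} (hM : ∀ n, |x n| ≤ M)
    (h : ∀ n k, |x n - (r (n, k) : ℝ)| < (1 / 2 : ℝ) ^ k) (n k : ℕ) :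
    |(r (n, k) : ℝ)| ≤ M + 1 := by
  have h1 : (1 / 2 : ℝ) ^ k ≤ 1 := pow_le_one₀ (by norm_num) (by norm_num)
  have h2 := abs_sub_abs_le_abs_sub (r (n, k) : ℝ) (x n)
  rw [abs_sub_comm] at h2
  linarith [h n k, hM n]

/-- The error of a product scales with the factors; a bound uniform in `n` keeps it under a single
constant, which is why boundedness is carried along. -/
theorem mul (hx : IsBddComputableSeq x) (hy : IsBddComputableSeq y) :
    IsBddComputableSeq fun n => x n * y n := by
  obtain ⟨⟨r, hr, h⟩, M, hM⟩ := hx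
  obtain ⟨⟨t, ht, h'⟩, M', hM'⟩ := hy
  refine ⟨isComputableSeq_of_le (hr.mul ht) (M + (M' + 1)) fun n k => ?_, M * M', fun n => ?_⟩
  · have h0 : 0 ≤ M := (abs_nonneg _).trans (hM 0)
    have ht' := abs_approx_le hM' h' n k
    push_cast
    calc |x n * y n - r (n, k) * t (n, k)|
        = |x n * (y n - t (n, k)) + t (n, k) * (x n - r (n, k))| := by ring_nf
      _ ≤ |x n| * |y n - t (n, k)| + |(t (n, k) : ℝ)| * |x n - r (n, k)| := by
        rw [← abs_mul, ← abs_mul]; exact abs_add_le _ _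
      _ ≤ M * (1 / 2 : ℝ) ^ k + (M' + 1) * (1 / 2 : ℝ) ^ k := by
        have := (abs_nonneg _).trans ht'
        gcongr
        exacts [hM n, (h' n k).le, (h n k).le]
      _ = _ := by ring
  · rw [abs_mul]
    have := (abs_nonneg _).trans (hM 0)
    gcongr
    exacts [hM n, hM' n]

theorem max_zero (hx : IsBddComputableSeq x) : IsBddComputableSeq fun n => max (x n) 0 := by
  obtain ⟨⟨r, hr, h⟩, M, hM⟩ := hx
  refine ⟨isComputableSeq_of_le (hr.max (.const 0)) 1 fun n k => ?_, M, fun n => ?_⟩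
  · push_cast
    rw [one_mul]
    exact (abs_max_sub_max_le_abs _ _ _).trans (h n k).le
  · rw [abs_of_nonneg (le_max_right _ _)]
    exact (max_le (le_abs_self _) (abs_nonneg _)).trans (hM n)

theorem exp (hx : IsBddComputableSeq x) : IsBddComputableSeq fun n => Real.exp (x n) := by
  obtain ⟨⟨r, hr, h⟩, M, hM⟩ := hx
  -- The power `N = 2 ^ (k + c)` must exceed the bound `M + 1` of the approximants. Taking them at
  -- precision `k + c` makes `δ` equal to `1 / N`.
  obtain ⟨c, hc⟩ := pow_unbounded_of_one_lt (M + 1) one_lt_two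
  have hM0 : 0 ≤ M := (abs_nonneg _).trans (hM 0)
  have hcomp : Computable fun p : ℕ × ℕ => p.2 + c :=
    Computable.snd.nat_add (Computable.const c)
  have hr' : IsComputableRat fun p : ℕ × ℕ => r (p.1, p.2 + c) :=
    hr.comp (Computable.fst.pair hcomp)
  have happ : IsComputableRat fun p : ℕ × ℕ =>
      (1 + r (p.1, p.2 + c) * (1 / 2 : ℚ) ^ (p.2 + c)) ^ (2 ^ (p.2 + c)) :=
    ((IsComputableRat.const 1).add (hr'.mul ((IsComputableRat.const (1 / 2)).pow hcomp))).pow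
      ((Computable.const 2).nat_pow hcomp)
  refine ⟨isComputableSeq_of_le happ (((M + 1) ^ 2 + 1) * Real.exp (M + 1)) fun n k => ?_,
    Real.exp M, fun n => ?_⟩
  · have hN : ((2 ^ (k + c) : ℕ) : ℝ) = 2 ^ (k + c) := by push_cast; rfl
    have key := exp_sub_one_add_div_pow_le (x := x n) (r := r (n, k + c)) (M := M + 1)
      (N := 2 ^ (k + c)) (by positivity) ((hM n).trans (by linarith)) (abs_approx_le hM h n _)
      (by
        rw [hN]
        exact hc.le.trans (pow_le_pow_right₀ one_le_two (by omega))) (h n _).le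
    rw [hN] at key
    have e : (r (n, k + c) : ℝ) / 2 ^ (k + c) = r (n, k + c) * (1 / 2) ^ (k + c) := by
      rw [one_div, inv_pow, div_eq_mul_inv]
    rw [e] at key
    push_cast
    refine key.trans ?_
    rw [mul_right_comm]
    gcongr
    have e' : (M + 1) ^ 2 / 2 ^ (k + c) = (M + 1) ^ 2 * (1 / 2) ^ (k + c) := by
      rw [one_div, inv_pow, div_eq_mul_inv]
    rw [e', ← add_one_mul]
    gcongr ?_ * ?_
    exact pow_le_pow_of_le_one (by norm_num) (by norm_num) (by omega)
  · rw [abs_of_pos (Real.exp_pos _)]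
    gcongr
    exact (le_abs_self _).trans (hM n)

/-- Truncation after `k` terms costs `M² 2⁻ᵏ`, and replacing `x n` by its `k`-th rational
approximation costs `(2M + 1) 2⁻ᵏ`. Only `ξ 1, …, ξ k` enter. -/
theorem gStar {ξ : ℕ → ℚ} (hξ : IsComputableRat ξ) (hξ0 : ∀ n, 0 ≤ ξ n)
    (hx : IsBddComputableSeq x) : IsBddComputableSeq fun n => gStar ξ (x n) := by
  obtain ⟨⟨r, hr, h⟩, M, hM⟩ := hx
  have hM0 : 0 ≤ M := (abs_nonneg _).trans (hM 0)
  have hj : Computable fun q : (ℕ × ℕ) × ℕ => q.2 + 1 := Computable.succ.comp Computable.snd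
  have hξ' : IsComputableRat fun q : (ℕ × ℕ) × ℕ => ξ (q.2 + 1) := hξ.comp hj
  have hr' : IsComputableRat fun q : (ℕ × ℕ) × ℕ => r q.1 := hr.comp Computable.fst
  have two : Computable fun _ : (ℕ × ℕ) × ℕ => 2 := Computable.const 2
  have hterm : IsComputableRat fun q : (ℕ × ℕ) × ℕ => (1 / 2 : ℚ) ^ (q.2 + 1) *
      (max (r q.1 - ξ (q.2 + 1)) 0 ^ 2 + max (-r q.1 - ξ (q.2 + 1)) 0 ^ 2) :=
    ((IsComputableRat.const (1 / 2)).pow hj).mul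
      ((((hr'.sub hξ').max (.const 0)).pow two).add (((hr'.neg.sub hξ').max (.const 0)).pow two))
  refine ⟨isComputableSeq_of_le (hterm.sum_range Computable.snd) (M ^ 2 + (M + (M + 1)))
    fun n k => ?_, M ^ 2, fun n => ?_⟩
  · have hcast : ((∑ j ∈ Finset.range k, (1 / 2 : ℚ) ^ (j + 1) *
        (max (r (n, k) - ξ (j + 1)) 0 ^ 2 + max (-r (n, k) - ξ (j + 1)) 0 ^ 2) : ℚ) : ℝ) =
        ∑ j ∈ Finset.range k, (1 / 2 : ℝ) ^ (j + 1) * gAux (ξ (j + 1)) (r (n, k)) := by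
      push_cast
      exact Finset.sum_congr rfl fun j _ => by rw [gAux_eq_add (Rat.cast_nonneg.2 (hξ0 _))]
    have hsum : |∑ j ∈ Finset.range k, (1 / 2 : ℝ) ^ (j + 1) * gAux (ξ (j + 1)) (x n) -
        ∑ j ∈ Finset.range k, (1 / 2 : ℝ) ^ (j + 1) * gAux (ξ (j + 1)) (r (n, k))| ≤
        (M + (M + 1)) * (1 / 2) ^ k := by
      rw [← Finset.sum_sub_distrib]
      have hC : 0 ≤ (M + (M + 1)) * (1 / 2 : ℝ) ^ k := by positivity
      calc _ ≤ ∑ j ∈ Finset.range k, (1 / 2 : ℝ) ^ (j + 1) * ((M + (M + 1)) * (1 / 2) ^ k) := by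
            refine (Finset.abs_sum_le_sum_abs _ _).trans (Finset.sum_le_sum fun j _ => ?_)
            rw [← mul_sub, abs_mul, abs_of_nonneg (by positivity : (0 : ℝ) ≤ (1 / 2) ^ (j + 1))]
            gcongr
            refine (abs_gAux_sub_le (Rat.cast_nonneg.2 (hξ0 _))).trans ?_
            gcongr
            exacts [hM n, abs_approx_le hM h n k, (h n k).le]
        _ ≤ ∑' j : ℕ, (1 / 2 : ℝ) ^ (j + 1) * ((M + (M + 1)) * (1 / 2) ^ k) :=
            (summable_half_pow_succ_mul _).sum_le_tsum _ fun j _ => by positivity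
        _ = _ := by
            simp_rw [pow_succ, mul_assoc]
            rw [tsum_mul_right, tsum_geometric_two]
            ring
    rw [hcast, add_mul]
    refine (abs_sub_le _ _ _).trans (add_le_add ((abs_gStar_sub_sum_le hξ0 (x n) k).trans ?_) hsum)
    rw [← sq_abs]
    gcongr
    exact hM n
  · have := abs_gStar_sub_sum_le hξ0 (x n) 0
    simp only [Finset.range_zero, Finset.sum_empty, sub_zero, pow_zero, mul_one] at this
    refine this.trans ?_
    rw [← sq_abs]
    gcongr
    exact hM n

end IsBddComputableSeq

end CoordMin

/-! ### A Specker sequence from the halting problem -/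

namespace CoordMin

open Nat.Partrec (Code)

/-- The program with number `k` stops on input `0` within `s` steps. -/
def haltsWithin (k s : ℕ) : Bool :=
  (Code.evaln s (Denumerable.ofNat Code k) 0).isSome

theorem computable_haltsWithin : Computable fun p : ℕ × ℕ => haltsWithin p.1 p.2 :=
  Primrec.option_isSome.to_comp.comp (Code.primrec_evaln.to_comp.comp
    ((Computable.snd.pair ((Computable.ofNat Code).comp Computable.fst)).pair (Computable.const 0)))

theorem haltsWithin_mono {k s t : ℕ} (hst : s ≤ t) (h : haltsWithin k s = true) :
    haltsWithin k t = true := by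
  obtain ⟨x, hx⟩ := Option.isSome_iff_exists.1 h
  exact Option.isSome_iff_exists.2 ⟨x, Code.evaln_mono hst hx⟩

theorem eval_dom_iff_haltsWithin {c : Code} :
    (c.eval 0).Dom ↔ ∃ s, haltsWithin (Encodable.encode c) s = true := by
  simp only [haltsWithin, Denumerable.ofNat_encode, Option.isSome_iff_exists, Part.dom_iff_mem,
    Code.evaln_complete, Option.mem_def]
  exact exists_comm

/-- The sum of `2⁻¹⁻ᵏ` over the numbers `k < n` of programs that stop within `n` steps. -/
def haltingSum (n : ℕ) : ℚ :=
  ∑ k ∈ Finset.range n, cond (haltsWithin k n) ((1 / 2) ^ (k + 1)) 0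

theorem isComputableRat_haltingSum : IsComputableRat haltingSum := by
  have h : IsComputableRat fun p : ℕ × ℕ =>
      cond (haltsWithin p.2 p.1) ((1 / 2 : ℚ) ^ (p.2 + 1)) 0 :=
    .cond (computable_haltsWithin.comp (Computable.snd.pair Computable.fst))
      ((IsComputableRat.const (1 / 2)).pow (Computable.succ.comp Computable.snd)) (.const 0)
  exact h.sum_range Computable.id

theorem haltingSum_term_nonneg (k n : ℕ) :
    (0 : ℚ) ≤ cond (haltsWithin k n) ((1 / 2) ^ (k + 1)) 0 := by
  cases haltsWithin k n
  · exact le_rfl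
  · simp only [cond_true]; positivity

theorem haltingSum_term_mono (k : ℕ) {m n : ℕ} (h : m ≤ n) :
    cond (haltsWithin k m) ((1 / 2 : ℚ) ^ (k + 1)) 0 ≤
      cond (haltsWithin k n) ((1 / 2) ^ (k + 1)) 0 := by
  cases hm : haltsWithin k m
  · exact haltingSum_term_nonneg k n
  · rw [haltsWithin_mono h hm]

theorem haltingSum_mono : Monotone haltingSum := fun _ n h =>
  (Finset.sum_le_sum fun k _ => haltingSum_term_mono k h).trans
    (Finset.sum_le_sum_of_subset_of_nonneg (Finset.range_mono h)
      fun k _ _ => haltingSum_term_nonneg k n)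

theorem haltingSum_le_one (n : ℕ) : haltingSum n ≤ 1 := by
  have h : haltingSum n ≤ ∑ k ∈ Finset.range n, (1 / 2 : ℚ) ^ (k + 1) :=
    Finset.sum_le_sum fun k _ => by
      cases haltsWithin k n
      · simp only [cond_false]; positivity
      · exact le_rfl
  refine h.trans ?_
  have : ∀ m, ∑ k ∈ Finset.range m, (1 / 2 : ℚ) ^ (k + 1) = 1 - (1 / 2) ^ m := fun m => by
    induction m with
    | zero => simp
    | succ m ih => rw [Finset.sum_range_succ, ih]; ring
  rw [this, sub_le_self_iff]
  positivity

/-- A program that stops late makes the sum jump. -/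
theorem haltingSum_add_le {k m n : ℕ} (hkm : k < m) (hmn : m ≤ n)
    (hm : haltsWithin k m = false) (hn : haltsWithin k n = true) :
    haltingSum m + (1 / 2) ^ (k + 1) ≤ haltingSum n := by
  have hk : k ∈ Finset.range m := Finset.mem_range.2 hkm
  have hk' : k ∈ Finset.range n := Finset.mem_range.2 (hkm.trans_le hmn)
  -- Term `k` rises from `0` to `(1 / 2) ^ (k + 1)`; all other terms can only grow.
  have h : ∑ j ∈ (Finset.range m).erase k, cond (haltsWithin j m) ((1 / 2 : ℚ) ^ (j + 1)) 0 ≤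
      ∑ j ∈ (Finset.range n).erase k, cond (haltsWithin j n) ((1 / 2 : ℚ) ^ (j + 1)) 0 :=
    (Finset.sum_le_sum fun j _ => haltingSum_term_mono j hmn).trans
      (Finset.sum_le_sum_of_subset_of_nonneg (Finset.erase_subset_erase _ (Finset.range_mono hmn))
        fun j _ _ => haltingSum_term_nonneg j n)
  have h1 := Finset.add_sum_erase _ (fun j => cond (haltsWithin j m) ((1 / 2 : ℚ) ^ (j + 1)) 0) hk
  have h2 := Finset.add_sum_erase _ (fun j => cond (haltsWithin j n) ((1 / 2 : ℚ) ^ (j + 1)) 0) hk'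
  simp only [hm, hn, cond_true, cond_false] at h1 h2
  unfold haltingSum
  linarith

/-- A strictly decreasing computable sequence whose limit is not computable. -/
def specker (c n : ℕ) : ℚ :=
  (1 / 2) ^ (c + 2) * (2 - haltingSum n + (1 / 2) ^ n)

variable {c : ℕ}

theorem isComputableRat_specker : IsComputableRat (specker c) :=
  (IsComputableRat.const _).mul (((IsComputableRat.const 2).sub isComputableRat_haltingSum).add
    ((IsComputableRat.const (1 / 2)).pow Computable.id))

/-- The halting sum is merely monotone; strictness comes from the summand `(1 / 2) ^ n`. -/
theorem strictAnti_specker : StrictAnti (specker c) := fun m n h => by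
  have h1 := haltingSum_mono h.le
  have h2 : (1 / 2 : ℚ) ^ n < (1 / 2) ^ m :=
    pow_lt_pow_right_of_lt_one₀ (by norm_num) (by norm_num) h
  unfold specker
  gcongr ?_ * ?_
  linarith

theorem le_specker (n : ℕ) : (1 / 2) ^ (c + 2) ≤ specker c n := by
  have h1 := haltingSum_le_one n
  have h2 : (0 : ℚ) < (1 / 2) ^ n := by positivity
  exact le_mul_of_one_le_right (by positivity) (by linarith)

/-- At stage `0` the halting sum is empty and the bracket equals `3`, so the value is three quarters
of `(1 / 2) ^ c`. -/
theorem specker_zero_lt : specker c 0 < (1 / 2) ^ c := by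
  have h : (0 : ℚ) < (1 / 2) ^ c := by positivity
  simp only [specker, haltingSum, Finset.range_zero, Finset.sum_empty, pow_add]
  linarith

theorem exists_tendsto_specker (c : ℕ) :
    ∃ s : ℝ, Tendsto (fun n => (specker c n : ℝ)) atTop (𝓝 s) := by
  have h : Antitone fun n => (specker c n : ℝ) := fun m n h =>
    Rat.cast_le.2 (strictAnti_specker.antitone h)
  refine ⟨_, tendsto_atTop_ciInf h ⟨0, ?_⟩⟩
  rintro _ ⟨n, rfl⟩
  exact Rat.cast_nonneg.2 ((by positivity : (0 : ℚ) ≤ (1 / 2) ^ (c + 2)).trans (le_specker n))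

/-- A computable limit would make non-halting recursively enumerable: once the sequence is close
enough to its limit, no room is left for the jump that a later halt of program `k` would cause. -/
theorem not_isComputableReal_of_tendsto_specker {s : ℝ}
    (hs : Tendsto (fun n => (specker c n : ℝ)) atTop (𝓝 s)) : ¬ IsComputableReal s := by
  rintro ⟨r, hr, h⟩
  have hle : ∀ n, s ≤ specker c n := fun n =>
    Antitone.le_of_tendsto (fun m n h => Rat.cast_le.2 (strictAnti_specker.antitone h)) hs n
  -- Put `ε = (1 / 2) ^ e k`. A late halt of program `k` lowers the sequence by at least `(1 / 2) ^
  -- (k + c + 3) = 4ε`, whereas a passed test leaves a distance of at most `3ε` to the limit.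
  let e : ℕ → ℕ := fun k => k + (c + 5)
  let test : Code → ℕ → Bool := fun d n =>
    let k := Encodable.encode d
    (decide (k + 1 ≤ n) && !haltsWithin k n) &&
      decide (specker c n ≤ r (e k) + 2 * (1 / 2) ^ e k)
  have htest : Computable₂ test := by
    have hk : Computable fun p : Code × ℕ => Encodable.encode p.1 :=
      Computable.encode.comp Computable.fst
    have he : Computable fun p : Code × ℕ => e (Encodable.encode p.1) :=
      hk.nat_add (Computable.const _)
    exact ((Computable.decide_nat_le (Computable.succ.comp hk) Computable.snd).bool_and
      (computable_haltsWithin.comp (hk.pair Computable.snd)).bool_not).bool_and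
      (IsComputableRat.decide_le (isComputableRat_specker.comp Computable.snd)
        ((hr.comp he).add ((IsComputableRat.const 2).mul ((IsComputableRat.const (1 / 2)).pow he))))
  -- The search for a stage that passes the test is partial recursive, so its domain is recursively
  -- enumerable; it remains to identify it with the non-halting codes.
  refine ComputablePred.halting_problem_not_re 0 ((Partrec.rfind htest.partrec₂).dom_re.of_eq
    fun d => ?_)
  have hdom : (Nat.rfind (test d)).Dom ↔ ∃ n, test d n = true := by
    rw [Nat.rfind_dom]
    exact exists_congr fun n => ⟨fun H => (Part.mem_some_iff.1 H.1).symm,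
      fun H => ⟨Part.mem_some_iff.2 H.symm, fun _ => trivial⟩⟩
  refine hdom.trans ?_
  set k := Encodable.encode d with hk
  have htest_iff : ∀ n, test d n = true ↔ (k + 1 ≤ n ∧ haltsWithin k n = false) ∧
      specker c n ≤ r (e k) + 2 * (1 / 2) ^ e k := fun n => by
    simp only [test, Bool.and_eq_true, decide_eq_true_eq, Bool.not_eq_true', ← hk]
  rw [eval_dom_iff_haltsWithin, ← hk]
  simp only [htest_iff]
  have hrk := abs_le.1 (h (e k))
  constructor
  · rintro ⟨n, ⟨hkn, hn⟩, hle'⟩ ⟨t, ht⟩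
    have hn' := haltsWithin_mono (le_max_right n t) ht
    have hjump := haltingSum_add_le hkn (le_max_left n t) hn hn'
    have hlim : s ≤ specker c n - (1 / 2) ^ (c + 2) * (1 / 2) ^ (k + 1) := by
      refine le_of_tendsto hs ?_
      filter_upwards [eventually_ge_atTop (max n t)] with m hm
      have h1 := hjump.trans (haltingSum_mono hm)
      have h2 : (1 / 2 : ℚ) ^ m ≤ (1 / 2) ^ n :=
        pow_le_pow_of_le_one (by norm_num) (by norm_num) ((le_max_left n t).trans hm)
      have : specker c m ≤ specker c n - (1 / 2) ^ (c + 2) * (1 / 2) ^ (k + 1) := by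
        unfold specker
        rw [← mul_sub]
        gcongr ?_ * ?_
        linarith
      have := (Rat.cast_le (K := ℝ)).2 this
      push_cast at this
      exact this
    have hle'' : (specker c n : ℝ) ≤ r (e k) + 2 * (1 / 2) ^ e k := by
      have := (Rat.cast_le (K := ℝ)).2 hle'
      push_cast at this
      exact this
    have he : (1 / 2 : ℝ) ^ (c + 2) * (1 / 2) ^ (k + 1) = 4 * (1 / 2) ^ e k := by
      simp only [e, pow_add]; ring
    have : (0 : ℝ) < (1 / 2) ^ e k := by positivity
    linarith
  · intro hnot
    have hpos : (0 : ℝ) < (1 / 2) ^ e k := by positivity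
    -- Convergence gives a stage below `s + ε`, and `s ≤ r (e k) + ε` explains the `2ε` in the test.
    obtain ⟨n, hn, hkn⟩ := ((hs.eventually_lt_const (lt_add_of_pos_right s hpos)).and
      (eventually_ge_atTop (k + 1))).exists
    refine ⟨n, ⟨hkn, by simpa using not_exists.1 hnot n⟩, ?_⟩
    have : (specker c n : ℝ) ≤ r (e k) + 2 * (1 / 2) ^ e k := by linarith
    rw [← Rat.cast_le (K := ℝ)]
    push_cast
    exact this

end CoordMin

/-! ### Smoothness and separate convexity of `f₂` -/

namespace CoordMin

/-- The sign of a real number cannot be decided effectively. Positive and negative parts of `x₂`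
replace the case distinction by operations that preserve computability and, once squared, C¹
regularity. -/
theorem fTwo_eq (ξ : ℕ → ℚ) (α : ℝ) (x : EuclideanSpace ℝ (Fin 2)) :
    fTwo ξ α x = gStar ξ (x 0) + ((max (x 1) 0) ^ 2 * Real.exp (α * x 0) +
      (max (-x 1) 0) ^ 2 * Real.exp (-(α * x 0))) := by
  unfold fTwo
  split_ifs with h
  · rw [max_eq_right h.le, max_eq_left (by linarith), neg_mul]; ring
  · rw [max_eq_left (not_lt.1 h), max_eq_right (by linarith)]; ring

section Regularity

variable {ξ : ℕ → ℚ}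

theorem contDiff_fTwo (hξ : ∀ n, 0 ≤ ξ n) (α : ℝ) : ContDiff ℝ 1 (fTwo ξ α) := by
  have h : ∀ i : Fin 2, ContDiff ℝ 1 fun x : EuclideanSpace ℝ (Fin 2) => x i :=
    contDiff_euclidean.1 contDiff_id
  rw [funext (fTwo_eq ξ α)]
  exact ((contDiff_gStar hξ).comp (h 0)).add
    (((contDiff_max_zero_sq.comp (h 1)).mul (contDiff_const.mul (h 0)).exp).add
      ((contDiff_max_zero_sq.comp (h 1).neg).mul (contDiff_const.mul (h 0)).neg.exp))

theorem strictConvexOn_exp_mul {β : ℝ} (hβ : β ≠ 0) :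
    StrictConvexOn ℝ univ fun x : ℝ => Real.exp (β * x) := by
  refine ⟨convex_univ, fun x _ y _ hxy s t hs ht hst => ?_⟩
  have := strictConvexOn_exp.2 (mem_univ (β * x)) (mem_univ (β * y))
    (fun h => hxy (mul_left_cancel₀ hβ h)) hs ht hst
  simp only [smul_eq_mul] at this ⊢
  convert this using 2
  ring

theorem strictConvexOn_fTwo_left (hξ : ∀ n, 0 ≤ ξ n) {α : ℝ} (hα : α ≠ 0) {x₂ : ℝ}
    (hx₂ : x₂ ≠ 0) : StrictConvexOn ℝ univ fun x₁ : ℝ => fTwo ξ α !₂[x₁, x₂] := by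
  have key : ∀ β : ℝ, β ≠ 0 →
      StrictConvexOn ℝ univ fun x₁ : ℝ => gStar ξ x₁ + x₂ ^ 2 * Real.exp (β * x₁) := by
    refine fun β hβ => (convexOn_gStar hξ).add_strictConvexOn
      ⟨convex_univ, fun x _ y _ hxy s t hs ht hst => ?_⟩
    have := (strictConvexOn_exp_mul hβ).2 (mem_univ x) (mem_univ y) hxy hs ht hst
    simp only [smul_eq_mul] at this ⊢
    have h2 : 0 < x₂ ^ 2 := by positivity
    nlinarith
  by_cases h : x₂ < 0
  · simpa [fTwo, h] using key (-α) (neg_ne_zero.2 hα)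
  · simpa [fTwo, h] using key α hα

theorem strictConvexOn_fTwo_right (α x₁ : ℝ) :
    StrictConvexOn ℝ univ fun x₂ : ℝ => fTwo ξ α !₂[x₁, x₂] := by
  have hd : ∀ t : ℝ, HasDerivAt (fun x₂ : ℝ => fTwo ξ α !₂[x₁, x₂])
      (2 * max t 0 * Real.exp (α * x₁) - 2 * max (-t) 0 * Real.exp (-(α * x₁))) t := by
    intro t
    have h1 := (hasDerivAt_max_zero_sq t).mul_const (Real.exp (α * x₁))
    have h2 := ((hasDerivAt_max_zero_sq (-t)).comp t (hasDerivAt_neg t)).mul_const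
      (Real.exp (-(α * x₁)))
    refine (((h1.add h2).const_add (gStar ξ x₁)).congr_deriv (by ring)).congr_of_eventuallyEq
      (Eventually.of_forall fun y => ?_)
    simp [fTwo_eq]
  refine StrictMono.strictConvexOn_univ_of_deriv
    (continuous_iff_continuousAt.2 fun t => (hd t).continuousAt) fun s t hst => ?_
  rw [(hd s).deriv, (hd t).deriv]
  have e1 := Real.exp_pos (α * x₁)
  have e2 := Real.exp_pos (-(α * x₁))
  -- For `t > 0` the positive-part term of the derivative grows strictly; for `s < t ≤ 0` the
  -- negative-part term does the work.
  rcases lt_or_ge 0 t with ht | ht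
  · have h1 : 2 * max s 0 * Real.exp (α * x₁) < 2 * max t 0 * Real.exp (α * x₁) := by
      gcongr
      rw [max_eq_left ht.le]
      exact max_lt hst ht
    have h2 : 2 * max (-t) 0 * Real.exp (-(α * x₁)) ≤ 2 * max (-s) 0 * Real.exp (-(α * x₁)) := by
      gcongr
    linarith
  · rw [max_eq_right ht, max_eq_right (hst.le.trans ht), max_eq_left (by linarith),
      max_eq_left (by linarith)]
    have : 2 * -t * Real.exp (-(α * x₁)) < 2 * -s * Real.exp (-(α * x₁)) := by gcongr
    linarith

end Regularity

/-! ### Computability of `f₂` on rectangles -/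

section Computability

variable {m : ℕ} {lo hi : Fin m → ℝ}

theorem convex_rect : Convex ℝ (rect lo hi) := by
  intro x hx y hy s t hs ht hst i
  exact convex_Icc (lo i) (hi i) (hx i) (hy i) hs ht hst

theorem isCompact_rect : IsCompact (rect lo hi) := by
  have h : rect lo hi = WithLp.toLp 2 '' Set.pi univ fun i => Icc (lo i) (hi i) := by
    ext x
    refine ⟨fun hx => ⟨WithLp.ofLp x, fun i _ => hx i, rfl⟩, ?_⟩
    rintro ⟨y, hy, rfl⟩ i
    exact hy i (mem_univ i)
  rw [h]
  exact (isCompact_univ_pi fun i => isCompact_Icc).image (PiLp.continuous_toLp 2 _)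

/-- A C¹ function is Lipschitz on a compact convex set, and any `c` with `K < 2 ^ c` yields the
recursive modulus `k + c`. -/
theorem isEffUniformContOn_rect {f : EuclideanSpace ℝ (Fin m) → ℝ} (hf : ContDiff ℝ 1 f) :
    IsEffUniformContOn f (rect lo hi) := by
  obtain ⟨K, hK⟩ := hf.contDiffOn.exists_lipschitzOnWith one_ne_zero (convex_rect (lo := lo))
    (isCompact_rect (hi := hi))
  obtain ⟨c, hc⟩ := pow_unbounded_of_one_lt (K : ℝ) one_lt_two
  refine ⟨fun k => k + c, Computable.id.nat_add (Computable.const c), fun k x hx y hy hxy => ?_⟩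
  have h := hK.dist_le_mul x hx y hy
  rw [Real.dist_eq, dist_eq_norm] at h
  calc |f x - f y| ≤ 2 ^ c * (1 / 2) ^ (k + c) := h.trans (by gcongr)
    _ = (1 / 2) ^ k := by
      rw [pow_add, mul_left_comm, ← mul_pow]
      norm_num

theorem IsComputableVecSeq.isBddComputableSeq {x : ℕ → EuclideanSpace ℝ (Fin m)}
    (hx : IsComputableVecSeq x) (hmem : ∀ n, x n ∈ rect lo hi) (i : Fin m) :
    IsBddComputableSeq fun n => x n i :=
  ⟨hx i, max |lo i| |hi i|, fun n => abs_le_max_abs_abs (hmem n i).1 (hmem n i).2⟩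

theorem isBddComputableSeq_fTwo {ξ : ℕ → ℚ} (hξc : IsComputableRat ξ) (hξ : ∀ n, 0 ≤ ξ n) {α : ℝ}
    (hα : IsComputableReal α) {x y : ℕ → ℝ} (hx : IsBddComputableSeq x)
    (hy : IsBddComputableSeq y) : IsBddComputableSeq fun n => fTwo ξ α !₂[x n, y n] := by
  have h := hα.isBddComputableSeq.mul hx
  have hp := hy.max_zero
  have hn := hy.neg.max_zero
  exact ((hx.gStar hξc hξ).add (((hp.mul hp).mul h.exp).add ((hn.mul hn).mul h.neg.exp))).of_eq
    fun n => by simp [fTwo_eq, sq]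

end Computability

/-! ### Local and global minimizers -/

section Minimizers

variable {ξ : ℕ → ℚ} {α ξs : ℝ}

theorem gStar_eq_zero_iff (hξ : ∀ n, 0 ≤ ξ n) (hanti : StrictAnti ξ)
    (hlim : Tendsto (fun n => (ξ n : ℝ)) atTop (𝓝 ξs)) (x : ℝ) :
    gStar ξ x = 0 ↔ |x| ≤ ξs := by
  have hle : ∀ n, ξs ≤ ξ n := fun n =>
    Antitone.le_of_tendsto (fun _ _ h => Rat.cast_le.2 (hanti.antitone h)) hlim n
  refine ⟨fun h => ?_, fun h => gStar_eq_zero_of_forall_le hξ fun n => h.trans (hle n)⟩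
  by_contra! hlt
  -- The series starts at `ξ 1`, hence the shift by one.
  obtain ⟨n, hn⟩ := (((tendsto_add_atTop_iff_nat 1).2 hlim).eventually_lt_const hlt).exists
  exact (gStar_pos hξ hn).ne' h

theorem fTwo_nonneg (hξ : ∀ n, 0 ≤ ξ n) (p : EuclideanSpace ℝ (Fin 2)) : 0 ≤ fTwo ξ α p := by
  rw [fTwo_eq]
  have := gStar_nonneg hξ (x := p 0)
  positivity

theorem fTwo_eq_zero_iff (hξ : ∀ n, 0 ≤ ξ n) (hg : ∀ x, gStar ξ x = 0 ↔ |x| ≤ ξs)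
    (p : EuclideanSpace ℝ (Fin 2)) : fTwo ξ α p = 0 ↔ p 0 ∈ Icc (-ξs) ξs ∧ p 1 = 0 := by
  have hexp : (if p 1 < 0 then Real.exp (-α * p 0) else Real.exp (α * p 0)) ≠ 0 := by
    split_ifs <;> exact (Real.exp_pos _).ne'
  have h0 : 0 ≤ p 1 ^ 2 * (if p 1 < 0 then Real.exp (-α * p 0) else Real.exp (α * p 0)) :=
    mul_nonneg (sq_nonneg _) (by split_ifs <;> exact (Real.exp_pos _).le)
  rw [fTwo, add_eq_zero_iff_of_nonneg (gStar_nonneg hξ) h0, hg, abs_le, mem_Icc, mul_eq_zero,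
    or_iff_left hexp, sq_eq_zero_iff]

theorem globalMinimizers_fTwo (hξ : ∀ n, 0 ≤ ξ n) (hg : ∀ x, gStar ξ x = 0 ↔ |x| ≤ ξs)
    (hξs : 0 ≤ ξs) {S : Set (EuclideanSpace ℝ (Fin 2))}
    (hS : {p : EuclideanSpace ℝ (Fin 2) | p 0 ∈ Icc (-ξs) ξs ∧ p 1 = 0} ⊆ S) :
    globalMinimizers (fTwo ξ α) S = {p | p 0 ∈ Icc (-ξs) ξs ∧ p 1 = 0} := by
  ext p
  refine ⟨fun h => ?_, fun h => ⟨hS h, fun y _ => ?_⟩⟩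
  · have h0 : (0 : EuclideanSpace ℝ (Fin 2)) ∈
        {p : EuclideanSpace ℝ (Fin 2) | p 0 ∈ Icc (-ξs) ξs ∧ p 1 = 0} := by simp [hξs]
    refine (fTwo_eq_zero_iff (α := α) hξ hg p).1 (le_antisymm ?_ (fTwo_nonneg hξ p))
    rw [← (fTwo_eq_zero_iff (α := α) hξ hg 0).2 h0]
    exact h.2 0 (hS h0)
  · rw [(fTwo_eq_zero_iff hξ hg p).2 h]
    exact fTwo_nonneg hξ y

/-- Since `f₂` is not jointly convex, local minimizers are excluded by descent paths ending at `p`.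
-/
theorem not_isLocalMinOn_of_path {E : Type*} [TopologicalSpace E] {f : E → ℝ} {S : Set E} {p : E}
    {γ : ℝ → E} (hγ : Continuous γ) (h1 : γ 1 = p)
    (h : ∀ t ∈ Ioo (0 : ℝ) 1, γ t ∈ S ∧ f (γ t) < f p) : ¬ IsLocalMinOn f S p := by
  intro hmin
  have hIoo : ∀ᶠ t in 𝓝[<] (1 : ℝ), t ∈ Ioo (0 : ℝ) 1 := Ioo_mem_nhdsLT zero_lt_one
  have ht : Tendsto γ (𝓝[<] 1) (𝓝[S] p) := tendsto_nhdsWithin_iff.2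
    ⟨h1 ▸ (hγ.tendsto 1).mono_left nhdsWithin_le_nhds, hIoo.mono fun t ht => (h t ht).1⟩
  obtain ⟨t, ht1, ht2⟩ := ((ht.eventually hmin).and hIoo).exists
  exact (h t ht2).2.not_ge ht1

/-- If `x₂ ≠ 0`, shrinking `x₂` keeps its sign, hence the exponential factor, and lowers the square.
If `x₂ = 0`, shrinking `x₁` works, as convexity and `g_*(0) = 0` give `g_*(t x₁) ≤ t g_*(x₁)`. -/
theorem isLocalMinOn_fTwo_mem (hξ : ∀ n, 0 ≤ ξ n) (hg : ∀ x, gStar ξ x = 0 ↔ |x| ≤ ξs)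
    (hξs : 0 ≤ ξs) {S : Set (EuclideanSpace ℝ (Fin 2))} {p : EuclideanSpace ℝ (Fin 2)}
    (hS : ∀ s ∈ Icc (0 : ℝ) 1, ∀ t ∈ Icc (0 : ℝ) 1, !₂[s * p 0, t * p 1] ∈ S)
    (hp : IsLocalMinOn (fTwo ξ α) S p) : p 0 ∈ Icc (-ξs) ξs ∧ p 1 = 0 := by
  have h1 : p 1 = 0 := by
    by_contra hne
    refine not_isLocalMinOn_of_path (γ := fun t : ℝ => !₂[p 0, t * p 1]) ?_ ?_
      (fun t ht => ⟨?_, ?_⟩) hp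
    · refine (PiLp.continuous_toLp 2 _).comp (continuous_pi fun i => ?_)
      fin_cases i <;> simp <;> fun_prop
    · ext i; fin_cases i <;> simp
    · simpa using hS 1 (by simp) t ⟨ht.1.le, ht.2.le⟩
    · have hlt : t * p 1 < 0 ↔ p 1 < 0 := by
        rw [mul_neg_iff]
        simp [ht.1, ht.1.le, not_lt.2]
      simp only [fTwo, Matrix.cons_val_zero, Matrix.cons_val_one, hlt]
      have hexp : 0 < (if p 1 < 0 then Real.exp (-α * p 0) else Real.exp (α * p 0)) := by
        split_ifs <;> exact Real.exp_pos _
      have hsq : (t * p 1) ^ 2 < p 1 ^ 2 := by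
        rw [mul_pow]
        exact mul_lt_of_lt_one_left (by positivity) (pow_lt_one₀ ht.1.le ht.2 two_ne_zero)
      gcongr
  refine ⟨?_, h1⟩
  rw [mem_Icc, ← abs_le, ← hg]
  by_contra hne
  have hpos : 0 < gStar ξ (p 0) := (gStar_nonneg hξ).lt_of_ne' hne
  refine not_isLocalMinOn_of_path (γ := fun t : ℝ => !₂[t * p 0, 0]) ?_ ?_
    (fun t ht => ⟨?_, ?_⟩) hp
  · refine (PiLp.continuous_toLp 2 _).comp (continuous_pi fun i => ?_)
    fin_cases i <;> simp <;> fun_prop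
  · ext i; fin_cases i <;> simp [h1]
  · simpa using hS t ⟨ht.1.le, ht.2.le⟩ 0 (by simp)
  · have hc := (convexOn_gStar hξ).2 (mem_univ (p 0)) (mem_univ 0) ht.1.le
      (sub_nonneg.2 ht.2.le) (by ring)
    have h0 : gStar ξ 0 = 0 := (hg 0).2 (by simpa using hξs)
    simp only [smul_eq_mul, mul_zero, add_zero, h0] at hc
    simp only [fTwo, Matrix.cons_val_zero, Matrix.cons_val_one, h1]
    simp only [ne_eq, OfNat.ofNat_ne_zero, not_false_eq_true, zero_pow, zero_mul, add_zero]
    exact hc.trans_lt (mul_lt_of_lt_one_left hpos ht.2)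

end Minimizers

/-! ### Reachable minimizers -/

section Reachability

variable {ξ : ℕ → ℚ} {α ξs a b : ℝ}

/-- The competitor is `-ξ_*`, where `g_*` vanishes. A larger `m` has a larger exponential term and
`g_*(m) ≥ 0`; the second bound follows by dropping the exponential term at `m`. -/
theorem le_neg_of_mem_minimizersFst (hξ : ∀ n, 0 ≤ ξ n) (hg : ∀ x, gStar ξ x = 0 ↔ |x| ≤ ξs)
    (hξs : 0 ≤ ξs) (hα : 0 < α) (ha : ξs ≤ a) {x₂ m : ℝ} (hx₂ : 0 < x₂)
    (hm : m ∈ minimizersFst (fTwo ξ α) (Icc (-a) a) x₂) : m ≤ -ξs ∧ gStar ξ m ≤ x₂ ^ 2 := by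
  have h := hm.2 (-ξs) ⟨by linarith, by linarith⟩
  have h0 : gStar ξ (-ξs) = 0 := (hg _).2 (by rw [abs_neg, abs_of_nonneg hξs])
  simp only [fTwo, Matrix.cons_val_zero, Matrix.cons_val_one, not_lt.2 hx₂.le,
    if_false, h0, zero_add] at h
  have hx₂' : 0 < x₂ ^ 2 := by positivity
  constructor
  · by_contra! hlt
    have : x₂ ^ 2 * Real.exp (α * -ξs) < x₂ ^ 2 * Real.exp (α * m) := by gcongr
    linarith [gStar_nonneg hξ (x := m)]
  · have h1 : 0 < x₂ ^ 2 * Real.exp (α * m) := by positivity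
    have h2 : x₂ ^ 2 * Real.exp (α * -ξs) ≤ x₂ ^ 2 :=
      mul_le_of_le_one_right hx₂'.le (Real.exp_le_one_iff.2 (by nlinarith))
    linarith

theorem ge_of_mem_minimizersFst (hξ : ∀ n, 0 ≤ ξ n) (hg : ∀ x, gStar ξ x = 0 ↔ |x| ≤ ξs)
    (hξs : 0 ≤ ξs) (hα : 0 < α) (ha : ξs ≤ a) {x₂ m : ℝ} (hx₂ : x₂ < 0)
    (hm : m ∈ minimizersFst (fTwo ξ α) (Icc (-a) a) x₂) : ξs ≤ m ∧ gStar ξ m ≤ x₂ ^ 2 := by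
  have h := hm.2 ξs ⟨by linarith, by linarith⟩
  have h0 : gStar ξ ξs = 0 := (hg _).2 (by rw [abs_of_nonneg hξs])
  simp only [fTwo, Matrix.cons_val_zero, Matrix.cons_val_one, hx₂, if_true, h0,
    zero_add] at h
  have hx₂' : 0 < x₂ ^ 2 := sq_pos_of_neg hx₂
  constructor
  · by_contra! hlt
    have : x₂ ^ 2 * Real.exp (-α * ξs) < x₂ ^ 2 * Real.exp (-α * m) := by
      gcongr ?_ * Real.exp ?_
      nlinarith
    linarith [gStar_nonneg hξ (x := m)]
  · have h1 : 0 < x₂ ^ 2 * Real.exp (-α * m) := by positivity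
    have h2 : x₂ ^ 2 * Real.exp (-α * ξs) ≤ x₂ ^ 2 :=
      mul_le_of_le_one_right hx₂'.le (Real.exp_le_one_iff.2 (by nlinarith))
    linarith

/-- As `g_*` increases with `|m|`, any `|m| ≥ c` costs at least `g_*(c) > 0`, which `x₂²` eventually
undercuts. -/
theorem eventually_abs_lt_of_gStar_le_sq (hξ : ∀ n, 0 ≤ ξ n)
    (hg : ∀ x, gStar ξ x = 0 ↔ |x| ≤ ξs) (hξs : 0 ≤ ξs) {c : ℝ} (hc : ξs < c) :
    ∀ᶠ x₂ in 𝓝 (0 : ℝ), ∀ m, gStar ξ m ≤ x₂ ^ 2 → |m| < c := by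
  have hc' : |c| = c := abs_of_nonneg (hξs.trans hc.le)
  have hpos : 0 < gStar ξ c := (gStar_nonneg hξ).lt_of_ne' fun h =>
    hc.not_ge (by simpa [hc'] using (hg c).1 h)
  have ht : Tendsto (fun x : ℝ => x ^ 2) (𝓝 0) (𝓝 0) := by
    simpa using (continuous_pow 2).tendsto (0 : ℝ)
  filter_upwards [ht.eventually_lt_const hpos] with x₂ hx₂ m hm
  by_contra! hle
  exact (hm.trans_lt hx₂).not_ge (gStar_le_gStar hξ (by rwa [hc']))

theorem tendsto_assignment_right (hξ : ∀ n, 0 ≤ ξ n) (hg : ∀ x, gStar ξ x = 0 ↔ |x| ≤ ξs)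
    (hξs : 0 ≤ ξs) (hα : 0 < α) (ha : ξs ≤ a) {R₂ : Set ℝ} {G : ℝ → ℝ}
    (hG : IsAssignmentFst (fTwo ξ α) (Icc (-a) a) R₂ G) :
    Tendsto G (𝓝[R₂ ∩ Ioi 0] 0) (𝓝 (-ξs)) := by
  refine tendsto_order.2 ⟨fun c hc => ?_, fun c hc => ?_⟩
  · filter_upwards [self_mem_nhdsWithin, nhdsWithin_le_nhds
      (eventually_abs_lt_of_gStar_le_sq hξ hg hξs (lt_neg_of_lt_neg hc))] with x hx hlt
    have := hlt _ (le_neg_of_mem_minimizersFst hξ hg hξs hα ha hx.2 (hG x hx.1)).2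
    linarith [(abs_lt.1 this).1]
  · filter_upwards [self_mem_nhdsWithin] with x hx
    exact (le_neg_of_mem_minimizersFst hξ hg hξs hα ha hx.2 (hG x hx.1)).1.trans_lt hc

theorem tendsto_assignment_left (hξ : ∀ n, 0 ≤ ξ n) (hg : ∀ x, gStar ξ x = 0 ↔ |x| ≤ ξs)
    (hξs : 0 ≤ ξs) (hα : 0 < α) (ha : ξs ≤ a) {R₂ : Set ℝ} {G : ℝ → ℝ}
    (hG : IsAssignmentFst (fTwo ξ α) (Icc (-a) a) R₂ G) :
    Tendsto G (𝓝[R₂ ∩ Iio 0] 0) (𝓝 ξs) := by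
  refine tendsto_order.2 ⟨fun c hc => ?_, fun c hc => ?_⟩
  · filter_upwards [self_mem_nhdsWithin] with x hx
    exact hc.trans_le (ge_of_mem_minimizersFst hξ hg hξs hα ha hx.2 (hG x hx.1)).1
  · filter_upwards [self_mem_nhdsWithin, nhdsWithin_le_nhds
      (eventually_abs_lt_of_gStar_le_sq hξ hg hξs hc)] with x hx hlt
    exact (abs_lt.1 (hlt _ (ge_of_mem_minimizersFst hξ hg hξs hα ha hx.2 (hG x hx.1)).2)).2

/-- Without an assignment function no point would be reachable, so the two endpoints need this
existence. -/
theorem exists_isAssignmentFst {f : EuclideanSpace ℝ (Fin 2) → ℝ} (hf : Continuous f)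
    {R₁ : Set ℝ} (hR₁ : IsCompact R₁) (hne : R₁.Nonempty) (R₂ : Set ℝ) :
    ∃ G, IsAssignmentFst f R₁ R₂ G := by
  have h : ∀ x₂ : ℝ, ∃ m, m ∈ minimizersFst f R₁ x₂ := fun x₂ => by
    have hc : Continuous fun x₁ : ℝ => f !₂[x₁, x₂] := by
      refine hf.comp ((PiLp.continuous_toLp 2 _).comp (continuous_pi fun i => ?_))
      fin_cases i <;> simp <;> fun_prop
    obtain ⟨m, hm, hmin⟩ := hR₁.exists_isMinOn hne hc.continuousOn
    exact ⟨m, hm, fun y hy => hmin hy⟩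
  choose G hG using h
  exact ⟨G, fun x₂ _ => hG x₂⟩

theorem tendsto_toLp_pair {l : Filter ℝ} {G : ℝ → ℝ} {c : ℝ} (hl : l ≤ 𝓝 0)
    (hG : Tendsto G l (𝓝 c)) :
    Tendsto (fun x₂ => (!₂[G x₂, x₂] : EuclideanSpace ℝ (Fin 2))) l (𝓝 !₂[c, 0]) := by
  refine ((PiLp.continuous_toLp 2 _).tendsto _).comp (tendsto_pi_nhds.2 fun i => ?_)
  fin_cases i
  · simpa using hG
  · exact tendsto_id.mono_left hl

theorem setOf_isReachableSnd_fTwo (hξ : ∀ n, 0 ≤ ξ n) (hg : ∀ x, gStar ξ x = 0 ↔ |x| ≤ ξs)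
    (hξs : 0 ≤ ξs) (hα : 0 < α) (ha : ξs ≤ a) (hb : 0 < b) :
    {p | IsReachableSnd (fTwo ξ α) (Icc (-a) a) (Icc (-b) b) p} = {!₂[-ξs, 0], !₂[ξs, 0]} := by
  have hmin := globalMinimizers_fTwo (α := α) (S := prodSet (Icc (-a) a) (Icc (-b) b)) hξ hg hξs
    fun p hp => ⟨⟨by linarith [hp.1.1], by linarith [hp.1.2]⟩, by
      rw [hp.2]; exact ⟨by linarith, hb.le⟩⟩
  have hIcc : Icc (-b) b ∈ 𝓝 (0 : ℝ) := Icc_mem_nhds (by linarith) hb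
  have hproj : ∀ {l : Filter ℝ} {G : ℝ → ℝ} {p : EuclideanSpace ℝ (Fin 2)},
      Tendsto (fun x₂ => (!₂[G x₂, x₂] : EuclideanSpace ℝ (Fin 2))) l (𝓝 p) →
      Tendsto G l (𝓝 (p 0)) := fun {l G p} h => by
    simpa [Function.comp_def] using
      ((PiLp.continuous_apply 2 (fun _ : Fin 2 => ℝ) 0).tendsto p).comp h
  obtain ⟨G, hG⟩ := exists_isAssignmentFst (contDiff_fTwo hξ α).continuous
    (isCompact_Icc (a := -a) (b := a)) (nonempty_Icc.2 (by linarith)) (Icc (-b) b)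
  ext p
  constructor
  · rintro ⟨hp, hlim⟩
    rw [hmin] at hp
    -- A global minimizer has second coordinate `0`, so only one-sided limits at `0` matter.
    rw [hp.2] at hlim
    have hext : ∀ c, p 0 = c → p = !₂[c, 0] := fun c hc => by
      ext i; fin_cases i <;> simp [hc, hp.2]
    rcases hlim with ⟨_, G, hG, hlim⟩ | ⟨_, G, hG, hlim⟩
    · exact Or.inl (hext _ (tendsto_nhds_unique (hproj hlim)
        (tendsto_assignment_right hξ hg hξs hα ha hG)))
    · exact Or.inr (hext _ (tendsto_nhds_unique (hproj hlim)
        (tendsto_assignment_left hξ hg hξs hα ha hG)))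
  · rintro (rfl | rfl)
    · refine ⟨by rw [hmin]; simp [hξs], Or.inl ?_⟩
      simp only [Matrix.cons_val_one, Matrix.cons_val_fin_one]
      refine ⟨?_, G, hG, tendsto_toLp_pair nhdsWithin_le_nhds
        (tendsto_assignment_right hξ hg hξs hα ha hG)⟩
      -- `Icc (-b) b` is a neighbourhood of `0`, so it does not affect the one-sided filter.
      rw [inter_comm, nhdsWithin_inter_of_mem' (nhdsWithin_le_nhds hIcc)]
      infer_instance
    · refine ⟨by rw [hmin]; simp [hξs], Or.inr ?_⟩
      simp only [Matrix.cons_val_one, Matrix.cons_val_fin_one]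
      refine ⟨?_, G, hG, tendsto_toLp_pair nhdsWithin_le_nhds
        (tendsto_assignment_left hξ hg hξs hα ha hG)⟩
      rw [inter_comm, nhdsWithin_inter_of_mem' (nhdsWithin_le_nhds hIcc)]
      infer_instance

end Reachability

end CoordMin

/-! ### The theorem -/

theorem mainTheorem4 (a b : ℝ) (ha : IsComputableReal a) (hb : IsComputableReal b)
    (ha0 : 0 < a) (hb0 : 0 < b) :
    ∃ (ξ : ℕ → ℚ) (ξs : ℝ),
      -- `ξs` is the non-computable limit of a strictly decreasing computable rational sequence
      (IsComputableRat ξ ∧ StrictAnti ξ ∧ Tendsto (fun n => (ξ n : ℝ)) atTop (𝓝 ξs) ∧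
        0 < ξs ∧ ξs < 1 ∧ ξs < a ∧ ¬ IsComputableReal ξs) ∧
      ∀ α : ℝ, IsComputableReal α → 0 < α →
        -- `f₂` is a computable continuous function on `[-a, a] × [-b, b]`
        IsComputableContOn (fTwo ξ α) (rect ![-a, -b] ![a, b]) ∧
        -- (1)
        ContDiff ℝ 1 (fTwo ξ α) ∧
        -- (2)
        (∀ x₂ : ℝ, x₂ ≠ 0 → StrictConvexOn ℝ univ (fun x₁ : ℝ => fTwo ξ α !₂[x₁, x₂])) ∧
        (∀ x₂ : ℝ, IsComputableReal x₂ →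
          IsComputableContOn (fun y : EuclideanSpace ℝ (Fin 1) => fTwo ξ α !₂[y 0, x₂])
            (rect ![-a] ![a])) ∧
        -- (3)
        (∀ x₁ : ℝ, StrictConvexOn ℝ univ (fun x₂ : ℝ => fTwo ξ α !₂[x₁, x₂])) ∧
        (∀ x₁ : ℝ, IsComputableReal x₁ →
          IsComputableContOn (fun y : EuclideanSpace ℝ (Fin 1) => fTwo ξ α !₂[x₁, y 0])
            (rect ![-b] ![b])) ∧
        -- (4) on the rectangle and on the whole plane
        (∀ S : Set (EuclideanSpace ℝ (Fin 2)),
          S = prodSet (Icc (-a) a) (Icc (-b) b) ∨ S = univ →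
          (∀ p ∈ S, IsLocalMinOn (fTwo ξ α) S p → p ∈ globalMinimizers (fTwo ξ α) S) ∧
          globalMinimizers (fTwo ξ α) S = {p | p 0 ∈ Icc (-ξs) ξs ∧ p 1 = 0}) ∧
        -- (5)
        {p | IsReachableSnd (fTwo ξ α) (Icc (-a) a) (Icc (-b) b) p} =
          {!₂[-ξs, 0], !₂[ξs, 0]} ∧
        (∀ p, IsReachableSnd (fTwo ξ α) (Icc (-a) a) (Icc (-b) b) p → ¬ IsComputableVec p) := by
  -- This `c` sets the scale of the Specker sequence: its first value, hence its limit, lies below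
  -- `min 1 a`.
  obtain ⟨c, hc⟩ := exists_pow_lt_of_lt_one (lt_min one_pos ha0) (one_half_lt_one (α := ℝ))
  obtain ⟨ξs, hlim⟩ := exists_tendsto_specker c
  have hξ : ∀ n, 0 ≤ specker c n := fun n => le_trans (by positivity) (le_specker n)
  have hpos : 0 < ξs := by
    refine lt_of_lt_of_le (by positivity : (0 : ℝ) < (1 / 2) ^ (c + 2))
      (ge_of_tendsto' hlim fun n => ?_)
    have := (Rat.cast_le (K := ℝ)).2 (le_specker (c := c) n)
    push_cast at this
    exact this
  have hlt : ξs < min 1 a := by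
    have h0 : ξs ≤ specker c 0 := Antitone.le_of_tendsto
      (fun _ _ h => Rat.cast_le.2 (strictAnti_specker.antitone h)) hlim 0
    have h1 := (Rat.cast_lt (K := ℝ)).2 (specker_zero_lt (c := c))
    push_cast at h1
    exact (h0.trans_lt h1).trans hc
  have hξa : ξs < a := hlt.trans_le (min_le_right _ _)
  have hnc := not_isComputableReal_of_tendsto_specker hlim
  have hg := gStar_eq_zero_iff hξ strictAnti_specker hlim
  refine ⟨specker c, ξs, ⟨isComputableRat_specker, strictAnti_specker, hlim, hpos,
    hlt.trans_le (min_le_left _ _), hξa, hnc⟩, fun α hα hα0 => ?_⟩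
  have hsmooth := contDiff_fTwo hξ α
  have hcoord : ContDiff ℝ 1 fun y : EuclideanSpace ℝ (Fin 1) => y 0 :=
    contDiff_euclidean.1 contDiff_id 0
  have hreach := setOf_isReachableSnd_fTwo hξ hg hpos.le hα0 hξa.le hb0
  refine ⟨⟨fun x hx hxc => ?_, isEffUniformContOn_rect hsmooth⟩, hsmooth,
    fun x₂ hx₂ => strictConvexOn_fTwo_left hξ hα0.ne' hx₂,
    fun x₂ hx₂ => ⟨fun y hy hyc => ?_, isEffUniformContOn_rect ?_⟩,
    strictConvexOn_fTwo_right α,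
    fun x₁ hx₁ => ⟨fun y hy hyc => ?_, isEffUniformContOn_rect ?_⟩, fun S hS => ?_, hreach,
    fun p hp hpc => ?_⟩
  · have h := isBddComputableSeq_fTwo isComputableRat_specker hξ hα
      (hxc.isBddComputableSeq hx 0) (hxc.isBddComputableSeq hx 1)
    refine (h.of_eq fun n => congrArg _ ?_).1
    ext i
    fin_cases i <;> rfl
  · exact (isBddComputableSeq_fTwo isComputableRat_specker hξ hα (hyc.isBddComputableSeq hy 0)
      hx₂.isBddComputableSeq).1
  · refine hsmooth.comp (contDiff_euclidean.2 fun i => ?_)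
    fin_cases i
    · exact hcoord
    · exact contDiff_const
  · exact (isBddComputableSeq_fTwo isComputableRat_specker hξ hα hx₁.isBddComputableSeq
      (hyc.isBddComputableSeq hy 0)).1
  · refine hsmooth.comp (contDiff_euclidean.2 fun i => ?_)
    fin_cases i
    · exact contDiff_const
    · exact hcoord
  · have hsub : {p : EuclideanSpace ℝ (Fin 2) | p 0 ∈ Icc (-ξs) ξs ∧ p 1 = 0} ⊆ S := by
      rintro p ⟨hp0, hp1⟩
      rcases hS with rfl | rfl
      · refine ⟨Icc_subset_Icc (neg_le_neg hξa.le) hξa.le hp0, ?_⟩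
        rw [hp1]
        exact ⟨by linarith, hb0.le⟩
      · exact mem_univ p
    have hmin := globalMinimizers_fTwo (α := α) hξ hg hpos.le hsub
    refine ⟨fun p hp hloc => ?_, hmin⟩
    rw [hmin]
    refine isLocalMinOn_fTwo_mem hξ hg hpos.le (fun s hs t ht => ?_) hloc
    have hscale : ∀ {r d x : ℝ}, r ∈ Icc (0 : ℝ) 1 → x ∈ Icc (-d) d → r * x ∈ Icc (-d) d :=
      fun {r d x} hr hx => by
        rw [mem_Icc, ← abs_le] at hx ⊢
        rw [abs_mul, abs_of_nonneg hr.1]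
        exact (mul_le_of_le_one_left (abs_nonneg x) hr.2).trans hx
    rcases hS with rfl | rfl
    · exact ⟨hscale hs hp.1, hscale ht hp.2⟩
    · exact mem_univ _
  · have hmem : p ∈ ({!₂[-ξs, 0], !₂[ξs, 0]} : Set (EuclideanSpace ℝ (Fin 2))) := hreach ▸ hp
    rcases hmem with rfl | rfl
    · exact hnc (by simpa using (hpc 0).neg)
    · exact hnc (hpc 0)
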